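/- Let $\alpha\in(0,1)$ and let $C_1,C_2,\dots$ be positive reals with $C_n\to\infty$ and $C_n^{\alpha}/n\to 0$. For every $n$, let $W_1,\dots,W_n$ (depending on $n$) be i.i.d. with density $$f_n(w)\propto w^{-\alpha-1}(1-e^{-w})\,\mathbf 1\{0<w\le C_n\}$$ (truncated BFRY random variables). Put $L=\sum_{i=1}^n W_i$ and $r_{ij}=W_iW_j/L$ for $1\le i<j\le n$. Let $X$ be the generalized random graph with odds ratios $r=(r_{ij})_{i<j}$: a random simple graph on the nodes $1,\dots,n$ such that, conditionally on $r$, each pair $i<j$ is linked with probability $r_{ij}/(1+r_{ij})$, independently over pairs; that is, $\Pr\{X=x\mid r\}=\prod_{i<j}\bigl(\tfrac{r_{ij}}{1+r_{ij}}\bigr)^{x_{ij}}\bigl(\tfrac{1}{1+r_{ij}}\bigr)^{1-x_{ij}}$ for every simple graph $x$ with adjacency matrix $(x_{ij})$. Let $D_1,\dots,D_n$ be the degrees of the nodes of $X$. Then: (1) For every integer $y\ge 0$, as $n\to\infty$ and uniformly over the nodes $i\le n$, $$\Pr\{D_i=y\}\to q(y),\qquad q(y)=\int_0^\infty \frac{w^{y}e^{-w}}{y!}\,\frac{\alpha}{\Gamma(1-\alpha)}\,w^{-\alpha-1}(1-e^{-w})\,dw=\frac{\alpha\,\Gamma(y-\alpha)\,(1-2^{\alpha-y})}{y!\,\Gamma(1-\alpha)},$$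 that is, the limit law is mixed Poisson with BFRY mixing. This law has a power law tail with exponent $1+\alpha$: there is a constant $c>0$ with $q(y)\sim c\,y^{-1-\alpha}$ as $y\to\infty$. (2) For every fixed $m$, the degrees $D_1,\dots,D_m$ are asymptotically independent as $n\to\infty$: for all sets $A_1,\dots,A_m\subseteq\{0,1,2,\dots\}$, $$\Pr\{D_1\in A_1,\dots,D_m\in A_m\}-\prod_{k=1}^m\Pr\{D_k\in A_k\}\to 0 .$$ -/

import Mathlib

open MeasureTheory ProbabilityTheory Filter Topology Asymptotics

/-- The unnormalised BFRY density `w ^ (-α - 1) * (1 - exp (-w))`. -/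
noncomputable def bfryWeight (α w : ℝ) : ℝ :=
  w ^ (-α - 1) * (1 - Real.exp (-w))

/-- The BFRY law with discount parameter `α`: density
`α / Γ(1 - α) * w ^ (-α - 1) * (1 - exp (-w))` on `(0, ∞)`. -/
noncomputable def bfry (α : ℝ) : Measure ℝ :=
  (volume.restrict (Set.Ioi 0)).withDensity fun w =>
    ENNReal.ofReal (α / Real.Gamma (1 - α) * bfryWeight α w)

/-- The normalising constant of the BFRY law truncated at `c`. -/
noncomputable def bfryTruncConst (α c : ℝ) : ℝ :=
  ∫ w in Set.Ioc 0 c, bfryWeight α w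

/-- The BFRY law truncated at `c`: density proportional to
`w ^ (-α - 1) * (1 - exp (-w))` on `(0, c]`. -/
noncomputable def bfryTrunc (α c : ℝ) : Measure ℝ :=
  (volume.restrict (Set.Ioc 0 c)).withDensity fun w =>
    ENNReal.ofReal (bfryWeight α w / bfryTruncConst α c)

/-- The pairs `(i, j)` of nodes with `i < j`. -/
abbrev NodePair (n : ℕ) : Type := {p : Fin n × Fin n // p.1 < p.2}

open Classical in
/-- The probability of the simple graph `x` when the pairs `i < j` are linked independently with
odds ratios `r`, that is, with probabilities `r / (1 + r)`. -/
noncomputable def grgLikelihood {n : ℕ} (r : NodePair n → ℝ) (x : SimpleGraph (Fin n)) : ℝ :=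
  ∏ p : NodePair n,
    if x.Adj p.1.1 p.1.2 then r p / (1 + r p) else 1 - r p / (1 + r p)

/-- `X ∣ r ∼ GRG(n, r)`: the random simple graph `X` on `n` nodes is a generalized random graph
with (random) odds ratios `r`; that is, conditionally on `r`, the graph `X` has the law
`grgLikelihood r`. -/
structure IsGRG {Ω : Type*} [MeasurableSpace Ω] (P : Measure Ω) {n : ℕ}
    (r : Ω → NodePair n → ℝ) (X : Ω → SimpleGraph (Fin n)) : Prop where
  measurable_odds : Measurable r
  measurableSet_eq : ∀ x : SimpleGraph (Fin n), MeasurableSet {ω | X ω = x}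
  condProb_eq : ∀ x : SimpleGraph (Fin n),
    P⟦{ω | X ω = x} | MeasurableSpace.comap r inferInstance⟧ =ᵐ[P]
      fun ω => grgLikelihood (r ω) x

/-- The odds ratios `r i j = w i * w j / L` with `L = ∑ i, w i`. -/
noncomputable def oddsRatio {n : ℕ} (w : Fin n → ℝ) (p : NodePair n) : ℝ :=
  w p.1.1 * w p.1.2 / ∑ i, w i

open Classical in
/-- The degree of a node of a simple graph on `n` nodes. -/
noncomputable def nodeDegree {n : ℕ} (G : SimpleGraph (Fin n)) (i : Fin n) : ℕ :=
  G.degree i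

/-- The mass at `y` of the mixed Poisson law whose random rate has law `ν` (a law on `[0, ∞)`). -/
noncomputable def mixedPoissonMass (ν : Measure ℝ) (y : ℕ) : ℝ :=
  ∫ w, Real.exp (-w) * w ^ y / (y.factorial : ℝ) ∂ν

@[to_additive]
theorem prod_nodePair_mul_prod_diag {M : Type*} [CommMonoid M] {n : ℕ} (F : Fin n → Fin n → M) :
    (∏ p : NodePair n, F p.1.1 p.1.2 * F p.1.2 p.1.1) * ∏ i, F i i = ∏ i, ∏ j, F i j := by
  have key : ∀ G : Fin n → Fin n → M,
      ∏ p : NodePair n, G p.1.1 p.1.2 = ∏ i, ∏ j, if i < j then G i j else 1 := by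
    intro G
    rw [← Fintype.prod_prod_type' (fun i j => if i < j then G i j else 1),
      ← Finset.prod_filter]
    exact (Finset.prod_subtype (Finset.univ.filter fun p : Fin n × Fin n => p.1 < p.2)
      (p := fun p : Fin n × Fin n => p.1 < p.2)
      (by simp) (fun p => G p.1 p.2)).symm
  have hdiag : ∏ i, F i i = ∏ i, ∏ j, if i = j then F i j else 1 := by simp
  have hswap : ∏ p : NodePair n, F p.1.2 p.1.1 = ∏ i, ∏ j, if j < i then F i j else 1 := by
    rw [key fun i j => F j i, Finset.prod_comm]
  rw [Finset.prod_mul_distrib, key, hswap, hdiag, ← Finset.prod_mul_distrib,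
    ← Finset.prod_mul_distrib]
  refine Finset.prod_congr rfl fun i _ => ?_
  rw [← Finset.prod_mul_distrib, ← Finset.prod_mul_distrib]
  refine Finset.prod_congr rfl fun j _ => ?_
  rcases lt_trichotomy i j with h | h | h
  · simp [h, h.ne, h.not_gt]
  · simp [h]
  · simp [h, h.ne', h.not_gt]

/-- A simple graph on `n` nodes is the set of its linked pairs. -/
noncomputable def graphEquivPairs (n : ℕ) : SimpleGraph (Fin n) ≃ (NodePair n → Prop) where
  toFun x p := x.Adj p.1.1 p.1.2
  invFun σ := SimpleGraph.mk (fun i j => (∃ h : i < j, σ ⟨(i, j), h⟩) ∨ ∃ h : j < i, σ ⟨(j, i), h⟩)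
    ⟨fun _ _ h => h.symm⟩ ⟨fun i h => by simp at h⟩
  left_inv x := by
    ext i j
    rcases lt_trichotomy i j with h | h | h
    · simp [h, h.not_gt]
    · simp [h]
    · simp [h, h.not_gt, x.adj_comm]
  right_inv σ := by
    ext ⟨⟨i, j⟩, h⟩
    have h' : i < j := h
    simp [h', h'.not_gt]

open Classical in
theorem sum_graph_prod_ite {n : ℕ} (A B : NodePair n → ℝ) :
    ∑ x : SimpleGraph (Fin n), ∏ p : NodePair n, (if x.Adj p.1.1 p.1.2 then A p else B p) =
      ∏ p, (A p + B p) := by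
  have hsum : ∑ x : SimpleGraph (Fin n),
      ∏ p : NodePair n, (if x.Adj p.1.1 p.1.2 then A p else B p) =
        ∑ σ : NodePair n → Prop, ∏ p, if σ p then A p else B p :=
    Fintype.sum_equiv (graphEquivPairs n) _ _ fun x => Finset.prod_congr rfl fun p _ =>
      if_congr Iff.rfl rfl rfl
  have := Finset.prod_univ_sum (ι := NodePair n) (κ := fun _ => Prop) (fun _ => Finset.univ)
    (fun p b => if b then A p else B p)
  simp only [Fintype.piFinset_univ] at this
  rw [hsum, ← this]
  refine Finset.prod_congr rfl fun p _ => ?_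
  simp

open Classical in
theorem prod_pow_nodeDegree {n : ℕ} (x : SimpleGraph (Fin n)) (s : Fin n → ℝ) :
    ∏ i, s i ^ nodeDegree x i =
      ∏ p : NodePair n, if x.Adj p.1.1 p.1.2 then s p.1.1 * s p.1.2 else 1 := by
  have h := prod_nodePair_mul_prod_diag fun i j => if x.Adj i j then s i else 1
  have h1 : ∀ i, ∏ j, (if x.Adj i j then s i else 1) = s i ^ nodeDegree x i := by
    intro i
    rw [← Finset.prod_filter, Finset.prod_const, nodeDegree, ← SimpleGraph.card_neighborFinset_eq_degree]
    congr 2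
    ext j
    simp
  simp only [SimpleGraph.irrefl, if_false, Finset.prod_const_one, mul_one, h1] at h
  rw [← h]
  refine Finset.prod_congr rfl fun p _ => ?_
  by_cases hp : x.Adj p.1.1 p.1.2
  · simp [hp, hp.symm]
  · have : ¬ x.Adj p.1.2 p.1.1 := fun h => hp h.symm
    simp [hp, this]

/-- The probability generating function of the degrees given the odds ratios. -/
theorem sum_grgLikelihood_mul_prod_pow {n : ℕ} (r : NodePair n → ℝ) (s : Fin n → ℝ) :
    ∑ x, grgLikelihood r x * ∏ i, s i ^ nodeDegree x i =
      ∏ p : NodePair n, (1 - r p / (1 + r p) * (1 - s p.1.1 * s p.1.2)) := by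
  classical
  have := sum_graph_prod_ite (fun p => r p / (1 + r p) * (s p.1.1 * s p.1.2))
    (fun p => 1 - r p / (1 + r p))
  convert this using 1
  · refine Finset.sum_congr (by congr) fun x _ => ?_
    rw [prod_pow_nodeDegree, grgLikelihood, ← Finset.prod_mul_distrib]
    refine Finset.prod_congr rfl fun p _ => ?_
    split_ifs <;> ring
  · refine Finset.prod_congr rfl fun p _ => ?_
    ring

theorem abs_prod_sub_prod_le {ι : Type*} (t : Finset ι) (a b : ι → ℝ)
    (ha : ∀ i ∈ t, |a i| ≤ 1) (hb : ∀ i ∈ t, |b i| ≤ 1) :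
    |∏ i ∈ t, a i - ∏ i ∈ t, b i| ≤ ∑ i ∈ t, |a i - b i| := by
  classical
  induction t using Finset.induction_on with
  | empty => simp
  | insert j t hj ih =>
    rw [Finset.prod_insert hj, Finset.prod_insert hj, Finset.sum_insert hj]
    have h1 : |∏ i ∈ t, b i| ≤ 1 := by
      rw [Finset.abs_prod]
      exact Finset.prod_le_one (fun _ _ => abs_nonneg _) fun i hi => hb i (by simp [hi])
    have h2 := ih (fun i hi => ha i (by simp [hi])) (fun i hi => hb i (by simp [hi]))
    have h3 := ha j (by simp)
    calc |a j * ∏ i ∈ t, a i - b j * ∏ i ∈ t, b i|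
        = |(a j - b j) * ∏ i ∈ t, b i + a j * (∏ i ∈ t, a i - ∏ i ∈ t, b i)| := by ring_nf
      _ ≤ |a j - b j| * |∏ i ∈ t, b i| + |a j| * |∏ i ∈ t, a i - ∏ i ∈ t, b i| := by
          rw [← abs_mul, ← abs_mul]; exact abs_add_le _ _
      _ ≤ |a j - b j| * 1 + 1 * |∏ i ∈ t, a i - ∏ i ∈ t, b i| := by gcongr
      _ ≤ _ := by linarith

theorem abs_one_sub_sub_exp_le {r a : ℝ} (hr : 0 ≤ r) (ha0 : 0 ≤ a) (ha1 : a ≤ 1) :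
    |1 - r / (1 + r) * a - Real.exp (-(r * a))| ≤ r ^ 2 * a := by
  have hra : 0 ≤ r * a := mul_nonneg hr ha0
  have hp : r / (1 + r) * a = r * a - r ^ 2 * a / (1 + r) := by field_simp; ring
  have h1 : 0 ≤ r ^ 2 * a / (1 + r) := by positivity
  have h2 : r ^ 2 * a / (1 + r) ≤ r ^ 2 * a := div_le_self (by positivity) (by linarith)
  have h3 : 1 - r * a ≤ Real.exp (-(r * a)) := by
    have := Real.add_one_le_exp (-(r * a)); linarith
  have h4 : Real.exp (-(r * a)) ≤ 1 - r * a + r ^ 2 * a := by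
    have h5 : Real.exp (-(r * a)) ≤ 1 / (1 + r * a) := by
      rw [Real.exp_neg, one_div]
      refine inv_anti₀ (by positivity) ?_
      have := Real.add_one_le_exp (r * a); linarith
    have h6 : 1 / (1 + r * a) ≤ 1 - r * a + (r * a) ^ 2 := by
      rw [div_le_iff₀ (by positivity)]
      nlinarith [pow_nonneg hra 3]
    have h7 : (r * a) ^ 2 ≤ r ^ 2 * a := by
      rw [mul_pow]; gcongr; nlinarith
    linarith
  rw [abs_le, hp]
  constructor <;> linarith

theorem abs_exp_neg_sub_exp_neg_le {x y : ℝ} (hx : 0 ≤ x) (hy : 0 ≤ y) :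
    |Real.exp (-x) - Real.exp (-y)| ≤ |x - y| := by
  wlog h : x ≤ y generalizing x y
  · rw [abs_sub_comm, abs_sub_comm x]; exact this hy hx (le_of_not_ge h)
  have h1 : Real.exp (-y) ≤ Real.exp (-x) := Real.exp_le_exp.2 (by linarith)
  rw [abs_of_nonneg (by linarith), abs_sub_comm, abs_of_nonneg (by linarith)]
  have h2 : Real.exp (-y) = Real.exp (-x) * Real.exp (-(y - x)) := by
    rw [← Real.exp_add]; ring_nf
  have h3 := Real.add_one_le_exp (-(y - x))
  have h4 : Real.exp (-x) ≤ 1 := Real.exp_le_one_iff.2 (by linarith)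
  rw [h2]
  nlinarith [Real.exp_pos (-x)]

/-- Given the weights, the generating function of the degrees is close to a product of
generating functions of Poisson laws. -/
theorem abs_pgf_sub_exp_le {n : ℕ} (w s : Fin n → ℝ) {C : ℝ} (hw0 : ∀ i, 0 < w i)
    (hwC : ∀ i, w i ≤ C) (hs0 : ∀ i, 0 ≤ s i) (hs1 : ∀ i, s i ≤ 1) :
    |∏ p : NodePair n,
        (1 - oddsRatio w p / (1 + oddsRatio w p) * (1 - s p.1.1 * s p.1.2)) -
      Real.exp (-∑ i, w i * (1 - s i))| ≤
      ((∑ i, w i ^ 2 * (1 - s i)) * (C + 1) + (∑ i, w i * (1 - s i)) ^ 2) / ∑ i, w i := by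
  rcases isEmpty_or_nonempty (Fin n) with hn | hn
  · have : IsEmpty (NodePair n) := ⟨fun p => hn.elim p.1.1⟩
    simp
  set L := ∑ i, w i with hL
  have hLpos : 0 < L := Finset.sum_pos (fun i _ => hw0 i) Finset.univ_nonempty
  set a : NodePair n → ℝ := fun p => 1 - s p.1.1 * s p.1.2 with ha
  have ha0 : ∀ p, 0 ≤ a p := fun p => by
    have := mul_le_one₀ (hs1 p.1.1) (hs0 p.1.2) (hs1 p.1.2); simp only [ha]; linarith
  have ha1 : ∀ p, a p ≤ 1 := fun p => by
    have := mul_nonneg (hs0 p.1.1) (hs0 p.1.2); simp only [ha]; linarith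
  have hr0 : ∀ p : NodePair n, 0 ≤ oddsRatio w p := fun p =>
    div_nonneg (mul_nonneg (hw0 _).le (hw0 _).le) hLpos.le
  set V := ∑ i, w i ^ 2 * (1 - s i) with hV
  set U := ∑ i, w i * (1 - s i) with hU
  have hU0 : 0 ≤ U := Finset.sum_nonneg fun i _ => mul_nonneg (hw0 i).le (by linarith [hs1 i])
  have hV0 : 0 ≤ V := Finset.sum_nonneg fun i _ => mul_nonneg (sq_nonneg _) (by linarith [hs1 i])
  -- replacing the Bernoulli variables by Poisson variables
  have step1 : |∏ p : NodePair n, (1 - oddsRatio w p / (1 + oddsRatio w p) * a p) -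
      ∏ p, Real.exp (-(oddsRatio w p * a p))| ≤ V * C / L := by
    refine (abs_prod_sub_prod_le _ _ _ (fun p _ => ?_) fun p _ => ?_).trans ?_
    · have h1 : oddsRatio w p / (1 + oddsRatio w p) ≤ 1 :=
        div_le_one_of_le₀ (by linarith [hr0 p]) (by linarith [hr0 p])
      have h0 : 0 ≤ oddsRatio w p / (1 + oddsRatio w p) :=
        div_nonneg (hr0 p) (by linarith [hr0 p])
      have h2 := mul_nonneg h0 (ha0 p)
      have h3 := mul_le_one₀ h1 (ha0 p) (ha1 p)
      rw [abs_le]; constructor <;> linarith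
    · rw [abs_of_pos (Real.exp_pos _), Real.exp_le_one_iff]
      linarith [mul_nonneg (hr0 p) (ha0 p)]
    calc ∑ p, |1 - oddsRatio w p / (1 + oddsRatio w p) * a p - Real.exp (-(oddsRatio w p * a p))|
        ≤ ∑ p : NodePair n, oddsRatio w p ^ 2 * a p :=
          Finset.sum_le_sum fun p _ => abs_one_sub_sub_exp_le (hr0 p) (ha0 p) (ha1 p)
      _ ≤ ∑ p : NodePair n, (w p.1.1 ^ 2 * (1 - s p.1.1) * w p.1.2 ^ 2 / L ^ 2 +
            w p.1.2 ^ 2 * (1 - s p.1.2) * w p.1.1 ^ 2 / L ^ 2) := by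
          refine Finset.sum_le_sum fun p _ => ?_
          have h1 : a p ≤ (1 - s p.1.1) + (1 - s p.1.2) := by
            have := mul_nonneg (sub_nonneg.2 (hs1 p.1.1)) (sub_nonneg.2 (hs1 p.1.2))
            simp only [ha]; linarith
          calc oddsRatio w p ^ 2 * a p
              ≤ oddsRatio w p ^ 2 * ((1 - s p.1.1) + (1 - s p.1.2)) := by gcongr
            _ = _ := by rw [oddsRatio, ← hL]; field_simp
      _ ≤ ∑ i, ∑ j, w i ^ 2 * (1 - s i) * w j ^ 2 / L ^ 2 := by
          rw [← sum_nodePair_add_sum_diag fun i j => w i ^ 2 * (1 - s i) * w j ^ 2 / L ^ 2]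
          refine le_add_of_nonneg_right (Finset.sum_nonneg fun i _ => ?_)
          have := sub_nonneg.2 (hs1 i)
          positivity
      _ = V * (∑ j, w j ^ 2) / L ^ 2 := by
          rw [hV, Finset.sum_mul_sum, Finset.sum_div]
          simp_rw [Finset.sum_div]
      _ ≤ V * (C * L) / L ^ 2 := by
          have : ∑ j, w j ^ 2 ≤ C * L := by
            rw [hL, Finset.mul_sum]
            exact Finset.sum_le_sum fun j _ => by nlinarith [hw0 j, hwC j]
          gcongr
      _ = V * C / L := by field_simp
  have hsum : ∑ p : NodePair n, oddsRatio w p * a p =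
      U - V / L - ∑ p : NodePair n, w p.1.1 * (1 - s p.1.1) * (w p.1.2 * (1 - s p.1.2)) / L := by
    have h := sum_nodePair_add_sum_diag fun i j => w i * (1 - s i) * w j / L
    have h1 : ∑ i, ∑ j, w i * (1 - s i) * w j / L = U := by
      simp_rw [← Finset.sum_div, ← Finset.mul_sum, ← Finset.sum_mul]
      rw [← hU, ← hL]; field_simp
    have h2 : ∑ i, w i * (1 - s i) * w i / L = V / L := by
      rw [hV, Finset.sum_div]; exact Finset.sum_congr rfl fun i _ => by ring
    rw [h1, h2] at h
    rw [← h, add_sub_cancel_right, ← Finset.sum_sub_distrib]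
    refine Finset.sum_congr rfl fun p _ => ?_
    simp only [oddsRatio, ha, ← hL]
    field_simp
    ring
  have hcross0 : 0 ≤ ∑ p : NodePair n, w p.1.1 * (1 - s p.1.1) * (w p.1.2 * (1 - s p.1.2)) / L :=
    Finset.sum_nonneg fun p _ => div_nonneg (mul_nonneg
      (mul_nonneg (hw0 _).le (sub_nonneg.2 (hs1 _)))
      (mul_nonneg (hw0 _).le (sub_nonneg.2 (hs1 _)))) hLpos.le
  have hcross : ∑ p : NodePair n, w p.1.1 * (1 - s p.1.1) * (w p.1.2 * (1 - s p.1.2)) / L ≤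
      U ^ 2 / L := by
    have h := sum_nodePair_add_sum_diag fun i j => w i * (1 - s i) * (w j * (1 - s j)) / L
    have h1 : ∑ i, ∑ j, w i * (1 - s i) * (w j * (1 - s j)) / L = U ^ 2 / L := by
      simp_rw [← Finset.sum_div, ← Finset.mul_sum, ← Finset.sum_mul]
      rw [← hU]; ring
    rw [h1] at h
    rw [← h, Finset.sum_add_distrib]
    have h2 : 0 ≤ ∑ i, w i * (1 - s i) * (w i * (1 - s i)) / L :=
      Finset.sum_nonneg fun i _ => div_nonneg (mul_self_nonneg _) hLpos.le
    have h3 : 0 ≤ ∑ p : NodePair n, w p.1.2 * (1 - s p.1.2) * (w p.1.1 * (1 - s p.1.1)) / L := by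
      simpa only [mul_comm] using hcross0
    linarith
  have step2 : |∏ p : NodePair n, Real.exp (-(oddsRatio w p * a p)) - Real.exp (-U)| ≤
      V / L + U ^ 2 / L := by
    rw [← Real.exp_sum, Finset.sum_neg_distrib]
    refine (abs_exp_neg_sub_exp_neg_le
      (Finset.sum_nonneg fun p _ => mul_nonneg (hr0 p) (ha0 p)) hU0).trans ?_
    have : 0 ≤ V / L := by positivity
    rw [hsum, abs_le]
    constructor <;> linarith
  calc _ ≤ _ := abs_sub_le _ (∏ p : NodePair n, Real.exp (-(oddsRatio w p * a p))) _
    _ ≤ V * C / L + (V / L + U ^ 2 / L) := add_le_add step1 step2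
    _ = _ := by ring

theorem measurable_bfryWeight (α : ℝ) : Measurable (bfryWeight α) := by
  unfold bfryWeight; fun_prop

theorem bfryWeight_nonneg (α : ℝ) {w : ℝ} (hw : 0 ≤ w) : 0 ≤ bfryWeight α w :=
  mul_nonneg (Real.rpow_nonneg hw _) (sub_nonneg.2 (Real.exp_le_one_iff.2 (by linarith)))

theorem bfryWeight_pos (α : ℝ) {w : ℝ} (hw : 0 < w) : 0 < bfryWeight α w :=
  mul_pos (Real.rpow_pos_of_pos hw _) (sub_pos.2 (Real.exp_lt_one_iff.2 (by linarith)))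

theorem integrableOn_rpow_mul_one_sub_exp {α t : ℝ} (hα0 : 0 < α) (hα1 : α < 1) (ht : 0 < t) :
    IntegrableOn (fun w => w ^ (-α - 1) * (1 - Real.exp (-(t * w)))) (Set.Ioi 0) := by
  have hmeas : Measurable fun w : ℝ => w ^ (-α - 1) * (1 - Real.exp (-(t * w))) := by fun_prop
  rw [← Set.Ioc_union_Ioi_eq_Ioi zero_le_one]
  refine IntegrableOn.union ?_ ?_
  · have h1 : IntegrableOn (fun w : ℝ => t * w ^ (-α)) (Set.Ioc 0 1) := by
      have := (intervalIntegral.intervalIntegrable_rpow' (a := 0) (b := 1) (r := -α)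
        (by linarith)).const_mul t
      rwa [intervalIntegrable_iff_integrableOn_Ioc_of_le zero_le_one] at this
    refine Integrable.mono' h1 hmeas.aestronglyMeasurable ?_
    filter_upwards [ae_restrict_mem measurableSet_Ioc] with w hw
    have hw0 : 0 < w := hw.1
    have h2 : 0 ≤ 1 - Real.exp (-(t * w)) :=
      sub_nonneg.2 (Real.exp_le_one_iff.2 (by nlinarith))
    have h3 : 1 - Real.exp (-(t * w)) ≤ t * w := by
      have := Real.add_one_le_exp (-(t * w)); linarith
    rw [Real.norm_of_nonneg (mul_nonneg (Real.rpow_nonneg hw0.le _) h2)]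
    calc w ^ (-α - 1) * (1 - Real.exp (-(t * w))) ≤ w ^ (-α - 1) * (t * w) := by gcongr
      _ = t * (w ^ (-α - 1) * w ^ (1 : ℝ)) := by rw [Real.rpow_one]; ring
      _ = t * w ^ (-α) := by rw [← Real.rpow_add hw0]; ring_nf
  · have h1 : IntegrableOn (fun w : ℝ => w ^ (-α - 1)) (Set.Ioi 1) :=
      integrableOn_Ioi_rpow_of_lt (by linarith) one_pos
    refine Integrable.mono' h1 hmeas.aestronglyMeasurable ?_
    filter_upwards [ae_restrict_mem measurableSet_Ioi] with w hw
    have hw0 : 0 < w := one_pos.trans hw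
    have h2 : 0 ≤ 1 - Real.exp (-(t * w)) :=
      sub_nonneg.2 (Real.exp_le_one_iff.2 (by nlinarith))
    have h4 := Real.rpow_nonneg hw0.le (-α - 1)
    rw [Real.norm_of_nonneg (mul_nonneg h4 h2)]
    nlinarith [Real.exp_pos (-(t * w))]

theorem integrableOn_rpow_mul_exp {s t : ℝ} (hs : 0 < s) (ht : 0 < t) :
    IntegrableOn (fun w => w ^ (s - 1) * Real.exp (-(t * w))) (Set.Ioi 0) := by
  have := integrableOn_rpow_mul_exp_neg_mul_rpow (s := s - 1) (p := 1) (b := t)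
    (by linarith) one_pos ht
  simpa only [Real.rpow_one, neg_mul] using this

theorem integral_rpow_mul_one_sub_exp {α t : ℝ} (hα0 : 0 < α) (hα1 : α < 1) (ht : 0 < t) :
    ∫ w in Set.Ioi 0, w ^ (-α - 1) * (1 - Real.exp (-(t * w))) =
      t ^ α * Real.Gamma (1 - α) / α := by
  set F : ℝ → ℝ := fun w => -(w ^ (-α) / α * (1 - Real.exp (-(t * w)))) with hF
  have hint1 := integrableOn_rpow_mul_one_sub_exp hα0 hα1 ht
  have hint2 : IntegrableOn (fun w => t / α * (w ^ (1 - α - 1) * Real.exp (-(t * w))))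
      (Set.Ioi 0) := (integrableOn_rpow_mul_exp (sub_pos.2 hα1) ht).const_mul _
  have hderiv : ∀ w ∈ Set.Ioi (0 : ℝ), HasDerivAt F (w ^ (-α - 1) * (1 - Real.exp (-(t * w))) -
      t / α * (w ^ (1 - α - 1) * Real.exp (-(t * w)))) w := by
    intro w hw
    have h1 := (Real.hasDerivAt_rpow_const (x := w) (p := -α) (Or.inl hw.ne')).div_const α
    have h2 : HasDerivAt (fun w => 1 - Real.exp (-(t * w))) (t * Real.exp (-(t * w))) w := by
      have := (((hasDerivAt_id w).const_mul t).neg.exp).const_sub 1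
      refine this.congr_deriv ?_
      simp; ring
    refine (h1.mul h2).neg.congr_deriv ?_
    rw [show 1 - α - 1 = -α by ring]
    field_simp
    ring
  have hbound0 : ∀ w ∈ Set.Ioi (0 : ℝ), |F w| ≤ t / α * w ^ (1 - α) := by
    intro w hw
    have hw0 : 0 < w := hw
    have h2 : 0 ≤ 1 - Real.exp (-(t * w)) :=
      sub_nonneg.2 (Real.exp_le_one_iff.2 (by nlinarith))
    have h3 : 1 - Real.exp (-(t * w)) ≤ t * w := by
      have := Real.add_one_le_exp (-(t * w)); linarith
    rw [hF, abs_neg, abs_of_nonneg (by positivity)]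
    calc w ^ (-α) / α * (1 - Real.exp (-(t * w))) ≤ w ^ (-α) / α * (t * w) := by gcongr
      _ = t / α * (w ^ (-α) * w ^ (1 : ℝ)) := by rw [Real.rpow_one]; ring
      _ = _ := by rw [← Real.rpow_add hw0]; ring_nf
  have hbound1 : ∀ w ∈ Set.Ioi (0 : ℝ), |F w| ≤ w ^ (-α) / α := by
    intro w hw
    have hw0 : 0 < w := hw
    have h2 : 0 ≤ 1 - Real.exp (-(t * w)) :=
      sub_nonneg.2 (Real.exp_le_one_iff.2 (by nlinarith))
    have h3 : 0 ≤ w ^ (-α) / α := by positivity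
    rw [hF, abs_neg, abs_of_nonneg (by positivity)]
    nlinarith [Real.exp_pos (-(t * w))]
  have hF0 : Tendsto F (𝓝[>] 0) (𝓝 0) := by
    have h : Tendsto (fun w : ℝ => t / α * w ^ (1 - α)) (𝓝[>] 0) (𝓝 0) := by
      have h1 : ContinuousAt (fun w : ℝ => t / α * w ^ (1 - α)) 0 :=
        (Real.continuousAt_rpow_const 0 (1 - α) (Or.inr (by linarith))).const_mul _
      have h2 := h1.tendsto
      rw [Real.zero_rpow (by linarith), mul_zero] at h2
      exact h2.mono_left nhdsWithin_le_nhds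
    exact squeeze_zero_norm' (eventually_nhdsWithin_of_forall hbound0) h
  have hFtop : Tendsto F atTop (𝓝 0) := by
    have h := (tendsto_rpow_neg_atTop hα0).div_const α
    rw [zero_div] at h
    exact squeeze_zero_norm' ((eventually_gt_atTop 0).mono hbound1) h
  have hFz : F 0 = 0 := by simp [hF]
  have hcont : ContinuousWithinAt F (Set.Ici 0) 0 := by
    rw [← continuousWithinAt_Ioi_iff_Ici, ContinuousWithinAt, hFz]
    exact hF0
  have h := integral_Ioi_of_hasDerivAt_of_tendsto hcont hderiv (hint1.sub hint2) hFtop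
  rw [integral_sub hint1 hint2, integral_const_mul,
    Real.integral_rpow_mul_exp_neg_mul_Ioi (sub_pos.2 hα1) ht, hFz, sub_zero, sub_eq_zero] at h
  rw [h, one_div, Real.inv_rpow ht.le, Real.rpow_sub ht, Real.rpow_one]
  field_simp

theorem integrableOn_bfryWeight {α : ℝ} (hα0 : 0 < α) (hα1 : α < 1) :
    IntegrableOn (bfryWeight α) (Set.Ioi 0) := by
  have h := integrableOn_rpow_mul_one_sub_exp hα0 hα1 one_pos
  simp only [one_mul] at h
  exact h

theorem integral_bfryWeight {α : ℝ} (hα0 : 0 < α) (hα1 : α < 1) :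
    ∫ w in Set.Ioi 0, bfryWeight α w = Real.Gamma (1 - α) / α := by
  have h := integral_rpow_mul_one_sub_exp hα0 hα1 one_pos
  simp only [one_mul, Real.one_rpow] at h
  exact h

theorem integral_bfry {α : ℝ} (hα0 : 0 < α) (hα1 : α < 1) (f : ℝ → ℝ) :
    ∫ w, f w ∂bfry α =
      α / Real.Gamma (1 - α) * ∫ w in Set.Ioi 0, bfryWeight α w * f w := by
  have hc : 0 ≤ α / Real.Gamma (1 - α) :=
    div_nonneg hα0.le (Real.Gamma_pos_of_pos (sub_pos.2 hα1)).le
  rw [bfry, integral_withDensity_eq_integral_toReal_smul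
    ((measurable_bfryWeight α).const_mul _).ennreal_ofReal (by simp), ← integral_const_mul]
  refine setIntegral_congr_fun measurableSet_Ioi fun w hw => ?_
  rw [ENNReal.toReal_ofReal (mul_nonneg hc (bfryWeight_nonneg α (le_of_lt hw))), smul_eq_mul,
    mul_assoc]

theorem integral_bfry_one {α : ℝ} (hα0 : 0 < α) (hα1 : α < 1) : ∫ _, (1 : ℝ) ∂bfry α = 1 := by
  have hΓ := Real.Gamma_pos_of_pos (sub_pos.2 hα1)
  rw [integral_bfry hα0 hα1]
  simp only [mul_one]
  rw [integral_bfryWeight hα0 hα1]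
  field_simp

theorem isFiniteMeasure_bfry {α : ℝ} (hα0 : 0 < α) (hα1 : α < 1) : IsFiniteMeasure (bfry α) := by
  refine isFiniteMeasure_withDensity_ofReal ?_
  exact ((integrableOn_bfryWeight hα0 hα1).const_mul _).2

theorem ae_bfry_pos (α : ℝ) : ∀ᵐ w ∂bfry α, 0 < w :=
  (withDensity_absolutelyContinuous _ _).ae_le (ae_restrict_mem measurableSet_Ioi)

theorem mixedPoissonMass_nonneg (α : ℝ) (y : ℕ) : 0 ≤ mixedPoissonMass (bfry α) y := by
  refine integral_nonneg_of_ae ?_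
  filter_upwards [ae_bfry_pos α] with w hw
  simp only [Pi.zero_apply]
  positivity

theorem hasSum_pow_div_factorial (x : ℝ) :
    HasSum (fun y : ℕ => x ^ y / (y.factorial : ℝ)) (Real.exp x) := by
  rw [Real.exp_eq_exp_ℝ]
  exact NormedSpace.expSeries_div_hasSum_exp x

/-- The generating function of the mixed Poisson law. -/
theorem hasSum_mixedPoissonMass_mul_pow {α : ℝ} (hα0 : 0 < α) (hα1 : α < 1) {z : ℝ}
    (hz0 : 0 ≤ z) (hz1 : z ≤ 1) :
    HasSum (fun y => mixedPoissonMass (bfry α) y * z ^ y)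
      (∫ w, Real.exp (-(w * (1 - z))) ∂bfry α) := by
  have := isFiniteMeasure_bfry hα0 hα1
  have hexp : ∀ w : ℝ, HasSum (fun y : ℕ => Real.exp (-w) * w ^ y / (y.factorial : ℝ)) 1 := by
    intro w
    have h := (hasSum_pow_div_factorial w).mul_left (Real.exp (-w))
    rw [← Real.exp_add, neg_add_cancel, Real.exp_zero] at h
    simpa only [mul_div_assoc] using h
  have key := hasSum_integral_of_dominated_convergence (μ := bfry α)
    (F := fun (y : ℕ) w => Real.exp (-w) * w ^ y / (y.factorial : ℝ) * z ^ y)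
    (f := fun w => Real.exp (-(w * (1 - z))))
    (fun y w => Real.exp (-w) * w ^ y / (y.factorial : ℝ))
    (fun y => (by fun_prop : Measurable _).aestronglyMeasurable)
    (fun y => ?_) (.of_forall fun w => (hexp w).summable) ?_ (.of_forall fun w => ?_)
  · simpa only [mixedPoissonMass, integral_mul_const] using key
  · filter_upwards [ae_bfry_pos α] with w hw
    rw [Real.norm_of_nonneg (by positivity)]
    exact mul_le_of_le_one_right (by positivity) (pow_le_one₀ hz0 hz1)
  · simp only [(hexp _).tsum_eq]
    exact integrable_const 1
  · have h := (hasSum_pow_div_factorial (w * z)).mul_left (Real.exp (-w))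
    rw [← Real.exp_add, show -w + w * z = -(w * (1 - z)) by ring] at h
    have heq : (fun y : ℕ => Real.exp (-w) * ((w * z) ^ y / (y.factorial : ℝ))) =
        fun y : ℕ => Real.exp (-w) * w ^ y / (y.factorial : ℝ) * z ^ y :=
      funext fun y => by rw [mul_pow]; ring
    rwa [heq] at h

theorem mixedPoissonMass_bfry {α : ℝ} (hα0 : 0 < α) (hα1 : α < 1) (y : ℕ) :
    mixedPoissonMass (bfry α) y =
      α * Real.Gamma ((y : ℝ) - α) * (1 - (2 : ℝ) ^ (α - (y : ℝ))) /
        ((y.factorial : ℝ) * Real.Gamma (1 - α)) := by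
  have hΓ := Real.Gamma_pos_of_pos (sub_pos.2 hα1)
  rw [mixedPoissonMass, integral_bfry hα0 hα1]
  rcases Nat.eq_zero_or_pos y with rfl | hy
  · have h1 := integrableOn_rpow_mul_one_sub_exp hα0 hα1 one_pos
    have h2 := integrableOn_rpow_mul_one_sub_exp hα0 hα1 two_pos
    have h : ∫ w in Set.Ioi 0, bfryWeight α w *
        (Real.exp (-w) * w ^ 0 / (Nat.factorial 0 : ℝ)) =
        2 ^ α * Real.Gamma (1 - α) / α - 1 ^ α * Real.Gamma (1 - α) / α := by
      rw [← integral_rpow_mul_one_sub_exp hα0 hα1 one_pos,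
        ← integral_rpow_mul_one_sub_exp hα0 hα1 two_pos, ← integral_sub h2 h1]
      congr 1
      ext w
      rw [bfryWeight, show -(2 * w) = -w + -w by ring, Real.exp_add]
      simp
      ring
    have hΓ' : Real.Gamma (1 - α) = -α * Real.Gamma (-α) := by
      rw [← Real.Gamma_add_one (by linarith)]; ring_nf
    have h0 : Real.Gamma (-α) ≠ 0 := by
      rintro h0; rw [h0, mul_zero] at hΓ'; exact hΓ.ne' hΓ'
    rw [h, Nat.cast_zero, zero_sub, sub_zero, hΓ', Real.one_rpow]
    simp
    field_simp
    ring
  · have hs : 0 < (y : ℝ) - α := by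
      have : (1 : ℝ) ≤ y := by exact_mod_cast hy
      linarith
    have h1 := integrableOn_rpow_mul_exp hs one_pos
    have h2 := integrableOn_rpow_mul_exp hs two_pos
    have h : ∫ w in Set.Ioi 0, bfryWeight α w *
        (Real.exp (-w) * w ^ y / (y.factorial : ℝ)) =
        ((1 / 1) ^ ((y : ℝ) - α) * Real.Gamma (y - α) -
          (1 / 2) ^ ((y : ℝ) - α) * Real.Gamma (y - α)) / (y.factorial : ℝ) := by
      rw [← Real.integral_rpow_mul_exp_neg_mul_Ioi hs one_pos,
        ← Real.integral_rpow_mul_exp_neg_mul_Ioi hs two_pos, ← integral_sub h1 h2,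
        ← integral_div]
      refine setIntegral_congr_fun measurableSet_Ioi fun w hw => ?_
      have hw0 : 0 < w := hw
      have hpow : w ^ ((y : ℝ) - α - 1) = w ^ (-α - 1) * w ^ y := by
        rw [← Real.rpow_natCast, ← Real.rpow_add hw0]; ring_nf
      simp only [bfryWeight, hpow, show -(2 * w) = -w + -w by ring, Real.exp_add, one_mul]
      ring
    rw [h, one_div_one, Real.one_rpow, one_div, Real.inv_rpow two_pos.le, ← Real.rpow_neg two_pos.le,
      neg_sub]
    field_simp

theorem isEquivalent_mixedPoissonMass_bfry {α : ℝ} (hα0 : 0 < α) (hα1 : α < 1) :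
    ∃ c : ℝ, 0 < c ∧ (fun y : ℕ => mixedPoissonMass (bfry α) y) ~[atTop]
      fun y : ℕ => c * (y : ℝ) ^ (-1 - α) := by
  have hΓ := Real.Gamma_pos_of_pos (sub_pos.2 hα1)
  have hΓ' : Real.Gamma (1 - α) = -α * Real.Gamma (-α) := by
    rw [← Real.Gamma_add_one (by linarith)]; ring_nf
  have hΓ0 : Real.Gamma (-α) ≠ 0 := by
    rintro h0; rw [h0, mul_zero] at hΓ'; exact hΓ.ne' hΓ'
  refine ⟨α / Real.Gamma (1 - α), by positivity, ?_⟩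
  have hprod : ∀ y : ℕ, Real.Gamma ((y : ℝ) + 1 - α) =
      (∏ j ∈ Finset.range (y + 1), (-α + j)) * Real.Gamma (-α) := by
    intro y
    induction y with
    | zero => simp [hΓ']
    | succ y ih =>
      have h0 : (y : ℝ) + 1 - α ≠ 0 := by
        have : (0 : ℝ) ≤ y := y.cast_nonneg
        linarith
      rw [Finset.prod_range_succ, mul_right_comm, ← ih]
      have := Real.Gamma_add_one h0
      push_cast
      rw [show (y : ℝ) + 1 + 1 - α = y + 1 - α + 1 by ring, this]
      ring
  have h1 : Tendsto (fun y : ℕ => Real.Gamma (-α) / Real.GammaSeq (-α) y) atTop (𝓝 1) := by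
    have := (tendsto_const_nhds (x := Real.Gamma (-α))).div (Real.GammaSeq_tendsto_Gamma (-α)) hΓ0
    rwa [div_self hΓ0] at this
  have h2 : Tendsto (fun y : ℕ => 1 - (2 : ℝ) ^ (α - (y : ℝ))) atTop (𝓝 1) := by
    have h := tendsto_pow_atTop_nhds_zero_of_lt_one (r := (1 / 2 : ℝ)) (by norm_num) (by norm_num)
    have h' := (h.const_mul ((2 : ℝ) ^ α)).const_sub 1
    rw [mul_zero, sub_zero] at h'
    refine h'.congr fun y => ?_
    rw [Real.rpow_sub two_pos, Real.rpow_natCast, one_div, inv_pow, div_eq_mul_inv]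
  have h3 : Tendsto (fun y : ℕ => (y : ℝ) / (y - α)) atTop (𝓝 1) := by
    have h := (tendsto_natCast_div_add_atTop (-α) : Tendsto (fun n : ℕ => (n : ℝ) / (n + -α)) _ _)
    simpa only [← sub_eq_add_neg] using h
  refine isEquivalent_of_tendsto_one ?_
  have h4 := (h2.mul h1).mul h3
  rw [mul_one, mul_one] at h4
  refine h4.congr' ?_
  filter_upwards [eventually_ge_atTop 1] with y hy
  have hy1 : (1 : ℝ) ≤ y := by exact_mod_cast hy
  have hy0 : (0 : ℝ) < y := by linarith
  have hyα : 0 < (y : ℝ) - α := by linarith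
  have hΓy := Real.Gamma_pos_of_pos hyα
  have h5 : Real.Gamma (-α) / Real.GammaSeq (-α) y =
      (y - α) * Real.Gamma (y - α) / ((y : ℝ) ^ (-α) * y.factorial) := by
    have h := hprod y
    rw [show (y : ℝ) + 1 - α = y - α + 1 by ring, Real.Gamma_add_one hyα.ne'] at h
    rw [h, Real.GammaSeq, div_div_eq_mul_div, mul_comm (Real.Gamma (-α))]
  have h6 : (y : ℝ) ^ (-α) = (y : ℝ) ^ (-1 - α) * y := by
    rw [← Real.rpow_add_one hy0.ne']; ring_nf
  rw [Pi.div_apply, mixedPoissonMass_bfry hα0 hα1, h5, h6]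
  have h7 : (0 : ℝ) < (y : ℝ) ^ (-1 - α) := Real.rpow_pos_of_pos hy0 _
  field_simp

theorem abs_tsum_sub_sum_range_div_sub_le {q : ℕ → ℝ} (hq0 : ∀ y, 0 ≤ q y) (hq : HasSum q 1)
    {z : ℝ} (hz0 : 0 < z) (hz1 : z ≤ 1) (j : ℕ) :
    |(z ^ j)⁻¹ * (∑' y, q y * z ^ y - ∑ i ∈ Finset.range j, q i * z ^ i) - q j| ≤ z := by
  have hzj : 0 < z ^ j := pow_pos hz0 j
  have hs : Summable fun y => q y * z ^ y :=
    Summable.of_nonneg_of_le (fun y => mul_nonneg (hq0 y) (pow_nonneg hz0.le y))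
      (fun y => mul_le_of_le_one_right (hq0 y) (pow_le_one₀ hz0.le hz1)) hq.summable
  have hsplit := hs.sum_add_tsum_nat_add (j + 1)
  obtain ⟨R, hR⟩ : ∃ R : ℝ, R = ∑' y, q (y + (j + 1)) * z ^ (y + (j + 1)) := ⟨_, rfl⟩
  have hR0 : 0 ≤ R := hR ▸ tsum_nonneg fun y => mul_nonneg (hq0 _) (pow_nonneg hz0.le _)
  have hR1 : R ≤ z ^ (j + 1) := by
    have hs1 : Summable fun y => q (y + (j + 1)) := (summable_nat_add_iff (j + 1)).2 hq.summable
    have h1 : ∑' y, q (y + (j + 1)) ≤ 1 := by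
      have := hq.summable.sum_add_tsum_nat_add (j + 1)
      rw [hq.tsum_eq] at this
      linarith [Finset.sum_nonneg fun y (_ : y ∈ Finset.range (j + 1)) => hq0 y]
    calc R ≤ ∑' y, q (y + (j + 1)) * z ^ (j + 1) := by
          rw [hR]
          refine Summable.tsum_le_tsum (fun y => ?_)
            ((summable_nat_add_iff (f := fun y => q y * z ^ y) (j + 1)).2 hs) (hs1.mul_right _)
          exact mul_le_mul_of_nonneg_left
            (pow_le_pow_of_le_one hz0.le hz1 (Nat.le_add_left _ _)) (hq0 _)
      _ = (∑' y, q (y + (j + 1))) * z ^ (j + 1) := tsum_mul_right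
      _ ≤ z ^ (j + 1) := mul_le_of_le_one_left (pow_nonneg hz0.le _) h1
  have h2 : (z ^ j)⁻¹ * (∑' y, q y * z ^ y - ∑ i ∈ Finset.range j, q i * z ^ i) - q j =
      (z ^ j)⁻¹ * R := by
    rw [← hsplit, Finset.sum_range_succ, ← hR]
    field_simp
    ring
  rw [h2, abs_of_nonneg (mul_nonneg (inv_nonneg.2 hzj.le) hR0), inv_mul_le_iff₀ hzj, ← pow_succ]
  exact hR1

/-- A continuity theorem for generating functions: the mass at `j` is a limit of linear
combinations of powers and of masses at smaller points. -/
theorem tendsto_single_of_tendsto_pow {ι : Type*} {l : Filter ι} (Φ : ι → (ℕ → ℝ) →ₗ[ℝ] ℝ)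
    (hΦ : ∀ i g ε, (∀ y, |g y| ≤ ε) → |Φ i g| ≤ ε) {q : ℕ → ℝ} (hq0 : ∀ y, 0 ≤ q y)
    (hq : HasSum q 1) {c : ℝ} (hc : |c| ≤ 1)
    (h : ∀ z : ℝ, 0 ≤ z → z ≤ 1 →
      Tendsto (fun i => Φ i (fun y => z ^ y)) l (𝓝 (c * ∑' y, q y * z ^ y))) (j : ℕ) :
    Tendsto (fun i => Φ i (Pi.single j 1)) l (𝓝 (c * q j)) := by
  induction j using Nat.strong_induction_on with
  | _ j ih =>
  rw [Metric.tendsto_nhds]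
  intro ε hε
  obtain ⟨z, hz0, hz1, hzε⟩ : ∃ z : ℝ, 0 < z ∧ z ≤ 1 ∧ z ≤ ε / 4 :=
    ⟨min 1 (ε / 4), lt_min one_pos (by positivity), min_le_left _ _, min_le_right _ _⟩
  have hzj : 0 < z ^ j := pow_pos hz0 j
  set g : ℕ → ℝ := (z ^ j)⁻¹ • ((fun y => z ^ y) -
    ∑ i ∈ Finset.range j, z ^ i • (Pi.single i 1 : ℕ → ℝ)) with hg
  have hgy : ∀ y, |(Pi.single j 1 - g : ℕ → ℝ) y| ≤ z := by
    intro y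
    have h1 : g y = (z ^ j)⁻¹ * (z ^ y - if y < j then z ^ y else 0) := by
      simp [hg, Pi.single_apply]
    rw [Pi.sub_apply, h1]
    rcases lt_trichotomy y j with hy | rfl | hy
    · simp [hy, hy.ne, hz0.le]
    · simp [hzj.ne', hz0.le]
    · obtain ⟨d, rfl⟩ := Nat.exists_eq_add_of_lt hy
      have h2 : (z ^ j)⁻¹ * z ^ (j + d + 1) = z ^ (d + 1) := by
        rw [add_assoc, pow_add]; field_simp
      have h3 : z ^ (d + 1) ≤ z := by
        simpa using pow_le_pow_of_le_one hz0.le hz1 (Nat.le_add_left 1 d)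
      simp only [hy.not_gt, if_false, sub_zero, h2, Pi.single_apply, hy.ne', zero_sub, abs_neg]
      rwa [abs_of_nonneg (by positivity)]
  obtain ⟨T, hTdef⟩ : ∃ T : ℝ, T =
    (z ^ j)⁻¹ * (c * ∑' y, q y * z ^ y - ∑ i ∈ Finset.range j, z ^ i * (c * q i)) := ⟨_, rfl⟩
  have hT : Tendsto (fun i => Φ i g) l (𝓝 T) := by
    simp only [hg, map_smul, map_sub, map_sum, smul_eq_mul, hTdef]
    exact ((h z hz0.le hz1).sub (tendsto_finsetSum _ fun i hi =>
      (ih i (Finset.mem_range.1 hi)).const_mul _)).const_mul _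
  have hTc : |T - c * q j| ≤ z := by
    have h1 := abs_tsum_sub_sum_range_div_sub_le hq0 hq hz0 hz1 j
    have h2 : T - c * q j =
        c * ((z ^ j)⁻¹ * (∑' y, q y * z ^ y - ∑ i ∈ Finset.range j, q i * z ^ i) - q j) := by
      have h3 : ∑ i ∈ Finset.range j, z ^ i * (c * q i) =
          c * ∑ i ∈ Finset.range j, q i * z ^ i := by
        rw [Finset.mul_sum]; exact Finset.sum_congr rfl fun i _ => by ring
      rw [hTdef, h3]
      ring
    rw [h2, abs_mul]
    exact (mul_le_of_le_one_left (abs_nonneg _) hc).trans h1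
  filter_upwards [Metric.tendsto_nhds.1 hT (ε / 2) (by positivity)] with i hi
  rw [Real.dist_eq] at hi ⊢
  have h1 := hΦ i _ z hgy
  rw [map_sub] at h1
  calc |Φ i (Pi.single j 1) - c * q j|
      = |(Φ i (Pi.single j 1) - Φ i g) + (Φ i g - T) + (T - c * q j)| := by ring_nf
    _ ≤ |Φ i (Pi.single j 1) - Φ i g| + |Φ i g - T| + |T - c * q j| := abs_add_three _ _ _
    _ < ε := by linarith

theorem tsum_mul_mem_Icc {q f : ℕ → ℝ} (hq0 : ∀ y, 0 ≤ q y) (hq : HasSum q 1)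
    (hf0 : ∀ y, 0 ≤ f y) (hf1 : ∀ y, f y ≤ 1) :
    0 ≤ ∑' y, q y * f y ∧ ∑' y, q y * f y ≤ 1 := by
  refine ⟨tsum_nonneg fun y => mul_nonneg (hq0 y) (hf0 y), ?_⟩
  rw [← hq.tsum_eq]
  have hle : ∀ y, q y * f y ≤ q y := fun y => mul_le_of_le_one_right (hq0 y) (hf1 y)
  exact Summable.tsum_le_tsum hle (Summable.of_nonneg_of_le
    (fun y => mul_nonneg (hq0 y) (hf0 y)) hle hq.summable) hq.summable

section Continuity

variable {ι : Type*} {l : Filter ι} {m : ℕ} {G : ι → Type*} [∀ i, Fintype (G i)]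
  {p : ∀ i, G i → ℝ} {D : ∀ i, G i → Fin m → ℕ} {q : ℕ → ℝ}

open Classical in
theorem tendsto_sum_prod_finset_of_tendsto_pgf (hp0 : ∀ i x, 0 ≤ p i x)
    (hp1 : ∀ i, ∑ x, p i x = 1) (hq0 : ∀ y, 0 ≤ q y) (hq : HasSum q 1)
    (h : ∀ z : Fin m → ℝ, (∀ k, 0 ≤ z k) → (∀ k, z k ≤ 1) →
      Tendsto (fun i => ∑ x, p i x * ∏ k, z k ^ D i x k) l (𝓝 (∏ k, ∑' y, q y * z k ^ y)))
    (B : Fin m → Finset ℕ) :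
    Tendsto (fun i => ∑ x, p i x * ∏ k, (if D i x k ∈ B k then 1 else 0 : ℝ)) l
      (𝓝 (∏ k, ∑ y ∈ B k, q y)) := by
  have claim : ∀ s : Finset (Fin m), ∀ f : Fin m → ℕ → ℝ,
      (∀ k ∈ s, ∃ B : Finset ℕ, f k = fun y => if y ∈ B then 1 else 0) →
      (∀ k ∉ s, ∃ z : ℝ, 0 ≤ z ∧ z ≤ 1 ∧ f k = fun y => z ^ y) →
      Tendsto (fun i => ∑ x, p i x * ∏ k, f k (D i x k)) l (𝓝 (∏ k, ∑' y, q y * f k y)) := by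
    intro s
    induction s using Finset.induction_on with
    | empty =>
      intro f _ hf
      choose z hz0 hz1 hz using fun k => hf k (by simp)
      simp only [hz]
      exact h z hz0 hz1
    | insert k s hk ih =>
      intro f hfs hfz
      have hf01 : ∀ k y, 0 ≤ f k y ∧ f k y ≤ 1 := by
        intro k' y
        by_cases hk' : k' ∈ insert k s
        · obtain ⟨B, hB⟩ := hfs k' hk'
          rw [hB]; dsimp only; split_ifs <;> simp
        · obtain ⟨z, hz0, hz1, hz⟩ := hfz k' hk'
          rw [hz]
          exact ⟨pow_nonneg hz0 y, pow_le_one₀ hz0 hz1⟩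
      obtain ⟨B, hB⟩ := hfs k (by simp)
      set c : ℝ := ∏ k' ∈ Finset.univ.erase k, ∑' y, q y * f k' y with hc
      have hupd : ∀ (g : ℕ → ℝ) (F : Fin m → (ℕ → ℝ) → ℝ),
          ∏ k', F k' (Function.update f k g k') =
            (∏ k' ∈ Finset.univ.erase k, F k' (f k')) * F k g := by
        intro g F
        rw [← Finset.prod_erase_mul _ _ (Finset.mem_univ k), Function.update_self]
        congr 1
        refine Finset.prod_congr rfl fun k' hk' => ?_
        rw [Function.update_of_ne (Finset.ne_of_mem_erase hk')]
      let Φ : ι → (ℕ → ℝ) →ₗ[ℝ] ℝ := fun i =>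
        { toFun := fun g =>
            ∑ x, p i x * ((∏ k' ∈ Finset.univ.erase k, f k' (D i x k')) * g (D i x k))
          map_add' := fun g g' => by
            simp only [Pi.add_apply, mul_add, Finset.sum_add_distrib]
          map_smul' := fun a g => by
            simp only [Pi.smul_apply, smul_eq_mul, RingHom.id_apply, Finset.mul_sum]
            exact Finset.sum_congr rfl fun x _ => by ring }
      have hΦ : ∀ i g, Φ i g =
          ∑ x, p i x * ((∏ k' ∈ Finset.univ.erase k, f k' (D i x k')) * g (D i x k)) :=
        fun _ _ => rfl
      have hΦb : ∀ i g ε, (∀ y, |g y| ≤ ε) → |Φ i g| ≤ ε := by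
        intro i g ε hg
        rw [hΦ]
        refine (Finset.abs_sum_le_sum_abs _ _).trans ?_
        calc _ ≤ ∑ x, p i x * ε := by
              refine Finset.sum_le_sum fun x _ => ?_
              rw [abs_mul, abs_mul, abs_of_nonneg (hp0 i x)]
              refine mul_le_mul_of_nonneg_left ?_ (hp0 i x)
              have h1 : |∏ k' ∈ Finset.univ.erase k, f k' (D i x k')| ≤ 1 := by
                rw [abs_of_nonneg (Finset.prod_nonneg fun k' _ => (hf01 _ _).1)]
                exact Finset.prod_le_one (fun k' _ => (hf01 _ _).1) fun k' _ => (hf01 _ _).2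
              exact (mul_le_of_le_one_left (abs_nonneg _) h1).trans (hg _)
          _ = ε := by rw [← Finset.sum_mul, hp1, one_mul]
      have hc1 : |c| ≤ 1 := by
        have h1 := fun k' => tsum_mul_mem_Icc hq0 hq (fun y => (hf01 k' y).1)
          (fun y => (hf01 k' y).2)
        rw [hc, abs_of_nonneg (Finset.prod_nonneg fun k' _ => (h1 k').1)]
        exact Finset.prod_le_one (fun k' _ => (h1 k').1) fun k' _ => (h1 k').2
      have hpow : ∀ z : ℝ, 0 ≤ z → z ≤ 1 →
          Tendsto (fun i => Φ i (fun y => z ^ y)) l (𝓝 (c * ∑' y, q y * z ^ y)) := by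
        intro z hz0 hz1
        have h1 := ih (Function.update f k fun y => z ^ y) (fun k' hk' => ?_) (fun k' hk' => ?_)
        · rw [hupd _ fun _ g => ∑' y, q y * g y] at h1
          refine h1.congr fun i => ?_
          rw [hΦ]
          exact Finset.sum_congr rfl fun x _ => by rw [hupd _ fun k' g => g (D i x k')]
        · have : k' ≠ k := fun h => hk (h ▸ hk')
          rw [Function.update_of_ne this]
          exact hfs k' (Finset.mem_insert_of_mem hk')
        · rcases eq_or_ne k' k with rfl | hne
          · exact ⟨z, hz0, hz1, by rw [Function.update_self]⟩
          · rw [Function.update_of_ne hne]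
            exact hfz k' (by simp [hne, hk'])
      have hsingle := tendsto_single_of_tendsto_pow Φ hΦb hq0 hq hc1 hpow
      have hfk : f k = ∑ j ∈ B, (Pi.single j 1 : ℕ → ℝ) := by
        rw [hB]; ext y; simp [Pi.single_apply]
      have hlim := tendsto_finsetSum B fun j _ => hsingle j
      have hval : ∏ k, ∑' y, q y * f k y = ∑ j ∈ B, c * q j := by
        rw [← Finset.prod_erase_mul _ _ (Finset.mem_univ k), ← hc, ← Finset.mul_sum, hB]
        congr 1
        simp only [mul_ite, mul_one, mul_zero]
        rw [tsum_eq_sum (s := B) fun y hy => by simp [hy]]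
        exact Finset.sum_congr rfl fun y hy => by simp [hy]
      rw [hval]
      refine hlim.congr fun i => ?_
      rw [← map_sum, ← hfk, hΦ]
      exact Finset.sum_congr rfl fun x _ => by
        rw [Finset.prod_erase_mul _ _ (Finset.mem_univ k)]
  have h1 := claim Finset.univ (fun k y => if y ∈ B k then 1 else 0) (fun k _ => ⟨B k, rfl⟩)
    (fun k hk => absurd (Finset.mem_univ k) hk)
  convert h1 using 2
  refine Finset.prod_congr rfl fun k _ => ?_
  simp only [mul_ite, mul_one, mul_zero]
  rw [tsum_eq_sum (s := B k) fun y hy => by simp [hy]]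
  exact Finset.sum_congr rfl fun y hy => by simp [hy]

open Classical in
/-- Convergence of the joint generating functions to a product of generating functions of `q`
implies convergence of the probabilities of products of sets. -/
theorem tendsto_sum_ite_of_tendsto_pgf (hp0 : ∀ i x, 0 ≤ p i x)
    (hp1 : ∀ i, ∑ x, p i x = 1) (hq0 : ∀ y, 0 ≤ q y) (hq : HasSum q 1)
    (h : ∀ z : Fin m → ℝ, (∀ k, 0 ≤ z k) → (∀ k, z k ≤ 1) →
      Tendsto (fun i => ∑ x, p i x * ∏ k, z k ^ D i x k) l (𝓝 (∏ k, ∑' y, q y * z k ^ y)))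
    (A : Fin m → Set ℕ) :
    Tendsto (fun i => ∑ x, if ∀ k, D i x k ∈ A k then p i x else 0) l
      (𝓝 (∏ k, ∑' y, (A k).indicator q y)) := by
  have hfin := tendsto_sum_prod_finset_of_tendsto_pgf hp0 hp1 hq0 hq h
  set a : ℕ → ℝ := fun M => ∏ k, ∑ y ∈ (Finset.range M).filter (· ∈ A k), q y with ha
  set s : ℕ → ℝ := fun M => ∏ _k : Fin m, ∑ y ∈ Finset.range M, q y with hs
  have hatop : Tendsto a atTop (𝓝 (∏ k, ∑' y, (A k).indicator q y)) := by
    refine tendsto_finsetProd _ fun k _ => ?_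
    have := (hq.summable.indicator (A k)).hasSum.tendsto_sum_nat
    refine this.congr fun M => ?_
    rw [Finset.sum_filter]
    exact Finset.sum_congr rfl fun y _ => by simp [Set.indicator_apply]
  have hsone : Tendsto s atTop (𝓝 1) := by
    have := tendsto_finsetProd (Finset.univ : Finset (Fin m)) fun _ _ => hq.tendsto_sum_nat
    simpa [hs] using this
  rw [Metric.tendsto_nhds]
  intro ε hε
  obtain ⟨M, hM1, hM2⟩ := ((Metric.tendsto_nhds.1 hatop (ε / 4) (by positivity)).and
    (Metric.tendsto_nhds.1 hsone (ε / 4) (by positivity))).exists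
  filter_upwards [Metric.tendsto_nhds.1 (hfin fun k => (Finset.range M).filter (· ∈ A k))
    (ε / 4) (by positivity), Metric.tendsto_nhds.1 (hfin fun _ => Finset.range M)
    (ε / 4) (by positivity)] with i hi1 hi2
  rw [Real.dist_eq, abs_lt] at *
  set e1 := ∑ x, p i x * ∏ k, (if D i x k ∈ (Finset.range M).filter (· ∈ A k) then 1 else 0 : ℝ)
  set e2 := ∑ x, p i x * ∏ k, (if D i x k ∈ Finset.range M then 1 else 0 : ℝ)
  have hle1 : e1 ≤ ∑ x, if ∀ k, D i x k ∈ A k then p i x else 0 := by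
    refine Finset.sum_le_sum fun x _ => ?_
    rw [Finset.prod_ite_zero, Finset.prod_const_one]
    have := hp0 i x
    split_ifs with h1 h2 h2
    · simp
    · exact absurd (fun k => (Finset.mem_filter.1 (h1 k (Finset.mem_univ k))).2) h2
    · simpa
    · simp
  have hle2 : (∑ x, if ∀ k, D i x k ∈ A k then p i x else 0) ≤ e1 + (1 - e2) := by
    rw [← hp1 i, ← Finset.sum_sub_distrib, ← Finset.sum_add_distrib]
    refine Finset.sum_le_sum fun x _ => ?_
    rw [Finset.prod_ite_zero, Finset.prod_const_one, Finset.prod_ite_zero, Finset.prod_const_one]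
    have := hp0 i x
    split_ifs with h1 h2 h3 h3 h2 h3 h3
    all_goals try simp
    all_goals try assumption
    exact absurd (fun k hk => Finset.mem_filter.2 ⟨h3 k hk, h1 k⟩) h2
  constructor <;> linarith

end Continuity

theorem bfryTruncConst_pos {α c : ℝ} (hα0 : 0 < α) (hα1 : α < 1) (hc : 0 < c) :
    0 < bfryTruncConst α c := by
  have hint : IntegrableOn (bfryWeight α) (Set.Ioc 0 c) :=
    (integrableOn_bfryWeight hα0 hα1).mono_set Set.Ioc_subset_Ioi_self
  rw [bfryTruncConst, setIntegral_pos_iff_support_of_nonneg_ae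
    ((ae_restrict_mem measurableSet_Ioc).mono fun w hw => bfryWeight_nonneg α hw.1.le) hint]
  have hsub : Set.Ioc 0 c ⊆ Function.support (bfryWeight α) ∩ Set.Ioc 0 c :=
    fun w hw => ⟨(bfryWeight_pos α hw.1).ne', hw⟩
  exact lt_of_lt_of_le (by simpa using hc) (measure_mono hsub)

theorem bfryTruncConst_le {α : ℝ} (hα0 : 0 < α) (hα1 : α < 1) (c : ℝ) :
    bfryTruncConst α c ≤ Real.Gamma (1 - α) / α := by
  rw [← integral_bfryWeight hα0 hα1]
  exact setIntegral_mono_set (integrableOn_bfryWeight hα0 hα1)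
    ((ae_restrict_mem measurableSet_Ioi).mono fun w hw => bfryWeight_nonneg α (le_of_lt hw))
    Set.Ioc_subset_Ioi_self.eventuallyLE

theorem integral_bfryTrunc {α c : ℝ} (hα0 : 0 < α) (hα1 : α < 1) (hc : 0 < c) (f : ℝ → ℝ) :
    ∫ w, f w ∂bfryTrunc α c =
      (∫ w in Set.Ioc 0 c, bfryWeight α w * f w) / bfryTruncConst α c := by
  have hZ := bfryTruncConst_pos hα0 hα1 hc
  rw [bfryTrunc, integral_withDensity_eq_integral_toReal_smul
    ((measurable_bfryWeight α).div_const _).ennreal_ofReal (by simp), ← integral_div]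
  refine setIntegral_congr_fun measurableSet_Ioc fun w hw => ?_
  rw [ENNReal.toReal_ofReal (div_nonneg (bfryWeight_nonneg α hw.1.le) hZ.le), smul_eq_mul]
  ring

theorem ae_bfryTrunc_mem (α c : ℝ) : ∀ᵐ w ∂bfryTrunc α c, w ∈ Set.Ioc 0 c :=
  (withDensity_absolutelyContinuous _ _).ae_le (ae_restrict_mem measurableSet_Ioc)

section Limit

variable {ι : Type*} {l : Filter ι} [l.IsCountablyGenerated] {α : ℝ} {C : ι → ℝ}

theorem tendsto_setIntegral_bfryWeight_mul (hα0 : 0 < α) (hα1 : α < 1) (hC : Tendsto C l atTop)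
    {F : ι → ℝ → ℝ} {f : ℝ → ℝ} (hFm : ∀ i, Measurable (F i))
    (hF1 : ∀ᶠ i in l, ∀ w, 0 < w → |F i w| ≤ 1)
    (hF : ∀ w, 0 < w → Tendsto (fun i => F i w) l (𝓝 (f w))) :
    Tendsto (fun i => ∫ w in Set.Ioc 0 (C i), bfryWeight α w * F i w) l
      (𝓝 (∫ w in Set.Ioi 0, bfryWeight α w * f w)) := by
  have heq : ∀ i, ∫ w in Set.Ioc 0 (C i), bfryWeight α w * F i w =
      ∫ w in Set.Ioi 0, (Set.Iic (C i)).indicator (fun w => bfryWeight α w * F i w) w := by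
    intro i
    rw [setIntegral_indicator measurableSet_Iic, Set.Ioi_inter_Iic]
  simp_rw [heq]
  refine tendsto_integral_filter_of_dominated_convergence (bfryWeight α)
    (.of_forall fun i => (((measurable_bfryWeight α).mul (hFm i)).indicator
      measurableSet_Iic).aestronglyMeasurable) ?_ (integrableOn_bfryWeight hα0 hα1) ?_
  · filter_upwards [hF1] with i hi
    filter_upwards [ae_restrict_mem measurableSet_Ioi] with w hw
    have hw0 := bfryWeight_nonneg α (le_of_lt hw)
    refine (norm_indicator_le_norm_self _ _).trans ?_
    rw [Real.norm_eq_abs, abs_mul, abs_of_nonneg hw0]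
    exact mul_le_of_le_one_right hw0 (hi w hw)
  · filter_upwards [ae_restrict_mem measurableSet_Ioi] with w hw
    refine ((hF w hw).const_mul (bfryWeight α w)).congr' ?_
    filter_upwards [hC.eventually_ge_atTop w] with i hi
    rw [Set.indicator_of_mem (Set.mem_Iic.2 hi)]

theorem tendsto_integral_bfryTrunc (hα0 : 0 < α) (hα1 : α < 1) (hC : Tendsto C l atTop)
    {F : ι → ℝ → ℝ} {f : ℝ → ℝ} (hFm : ∀ i, Measurable (F i))
    (hF1 : ∀ᶠ i in l, ∀ w, 0 < w → |F i w| ≤ 1)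
    (hF : ∀ w, 0 < w → Tendsto (fun i => F i w) l (𝓝 (f w))) :
    Tendsto (fun i => ∫ w, F i w ∂bfryTrunc α (C i)) l (𝓝 (∫ w, f w ∂bfry α)) := by
  have hΓ := Real.Gamma_pos_of_pos (sub_pos.2 hα1)
  have h1 := tendsto_setIntegral_bfryWeight_mul hα0 hα1 hC hFm hF1 hF
  have h2 : Tendsto (fun i => bfryTruncConst α (C i)) l (𝓝 (Real.Gamma (1 - α) / α)) := by
    have := tendsto_setIntegral_bfryWeight_mul (F := fun _ _ => 1) (f := fun _ => 1) hα0 hα1 hC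
      (fun _ => measurable_const) (by simp) (fun _ _ => tendsto_const_nhds)
    simp only [mul_one] at this
    rwa [integral_bfryWeight hα0 hα1] at this
  have h3 := h1.div h2 (by positivity)
  rw [integral_bfry hα0 hα1]
  convert h3.congr' ?_ using 2
  · field_simp
  · filter_upwards [hC.eventually_gt_atTop 0] with i hi
    rw [integral_bfryTrunc hα0 hα1 hi, Pi.div_apply]

end Limit

/-- The mean of the truncated BFRY law at `c` is at least of order `c ^ (1 - α)`. -/
theorem exists_le_integral_bfryTrunc {α : ℝ} (hα0 : 0 < α) (hα1 : α < 1) :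
    ∃ κ : ℝ, 0 < κ ∧ ∀ c, 2 ≤ c → κ * (c * c ^ (-α)) ≤ ∫ w, w ∂bfryTrunc α c := by
  have hΓ := Real.Gamma_pos_of_pos (sub_pos.2 hα1)
  have he : 0 < 1 - Real.exp (-1) := sub_pos.2 (Real.exp_lt_one_iff.2 (by norm_num))
  refine ⟨(1 - Real.exp (-1)) / 2 / (Real.Gamma (1 - α) / α), by positivity, fun c hc => ?_⟩
  have hc0 : 0 < c := by linarith
  have hZ := bfryTruncConst_pos hα0 hα1 hc0
  have hint : IntegrableOn (fun w => bfryWeight α w * w) (Set.Ioc 0 c) := by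
    refine Integrable.mono' (((integrableOn_bfryWeight hα0 hα1).mono_set
      Set.Ioc_subset_Ioi_self).mul_const c)
      ((measurable_bfryWeight α).mul measurable_id).aestronglyMeasurable ?_
    filter_upwards [ae_restrict_mem measurableSet_Ioc] with w hw
    have hw0 := bfryWeight_nonneg α hw.1.le
    rw [Real.norm_of_nonneg (mul_nonneg hw0 hw.1.le)]
    exact mul_le_mul_of_nonneg_left hw.2 hw0
  have hsub : Set.Ioc (c / 2) c ⊆ Set.Ioc 0 c := Set.Ioc_subset_Ioc_left (by linarith)
  have h1 : (1 - Real.exp (-1)) / 2 * (c * c ^ (-α)) ≤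
      ∫ w in Set.Ioc 0 c, bfryWeight α w * w := by
    calc (1 - Real.exp (-1)) / 2 * (c * c ^ (-α))
        = ∫ _ in Set.Ioc (c / 2) c, c ^ (-α) * (1 - Real.exp (-1)) := by
          rw [setIntegral_const, Real.volume_real_Ioc_of_le (by linarith), smul_eq_mul]; ring
      _ ≤ ∫ w in Set.Ioc (c / 2) c, bfryWeight α w * w := by
          refine setIntegral_mono_on (integrable_const _) (hint.mono_set hsub) measurableSet_Ioc
            fun w hw => ?_
          have hw1 : 1 ≤ w := by linarith [hw.1]
          have hw0 : 0 < w := by linarith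
          have h2 : bfryWeight α w * w = w ^ (-α) * (1 - Real.exp (-w)) := by
            rw [bfryWeight, show w ^ (-α) = w ^ (-α - 1) * w by
              rw [← Real.rpow_add_one hw0.ne']; ring_nf]
            ring
          have h3 : c ^ (-α) ≤ w ^ (-α) :=
            Real.rpow_le_rpow_of_nonpos hw0 hw.2 (by linarith)
          have h4 : Real.exp (-w) ≤ Real.exp (-1) := Real.exp_le_exp.2 (by linarith)
          rw [h2]
          exact mul_le_mul h3 (by linarith) he.le (Real.rpow_nonneg hw0.le _)
      _ ≤ _ := setIntegral_mono_set hint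
          ((ae_restrict_mem measurableSet_Ioc).mono fun w hw =>
            mul_nonneg (bfryWeight_nonneg α hw.1.le) hw.1.le) hsub.eventuallyLE
  have hpos : 0 < c * c ^ (-α) := mul_pos hc0 (Real.rpow_pos_of_pos hc0 _)
  rw [integral_bfryTrunc hα0 hα1 hc0, div_mul_eq_mul_div]
  exact div_le_div₀ ((by positivity : (0 : ℝ) ≤ _).trans h1) h1 hZ (bfryTruncConst_le hα0 hα1 c)

theorem le_sum_min_one {κ : Type*} (t : Finset κ) {a : κ → ℝ} (ha : ∀ k ∈ t, 0 ≤ a k) {x : ℝ}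
    (hx1 : x ≤ 1) (hx : x ≤ ∑ k ∈ t, a k) : x ≤ ∑ k ∈ t, min 1 (a k) := by
  by_cases h : ∃ k ∈ t, 1 ≤ a k
  · obtain ⟨k, hk, hk1⟩ := h
    calc x ≤ min 1 (a k) := by rwa [min_eq_left hk1]
      _ ≤ _ := Finset.single_le_sum (f := fun k => min 1 (a k))
        (fun k hk => le_min zero_le_one (ha k hk)) hk
  · push Not at h
    rwa [Finset.sum_congr rfl fun k hk => min_eq_right (h k hk).le]

section FixedSize

variable {Ω : Type*} [MeasurableSpace Ω] {P : Measure Ω} {n : ℕ}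

open Classical in
theorem measureReal_eq_sum_graph [IsFiniteMeasure P] {X : Ω → SimpleGraph (Fin n)}
    (hX : ∀ x, MeasurableSet {ω | X ω = x}) (Q : SimpleGraph (Fin n) → Prop) :
    P.real {ω | Q (X ω)} = ∑ x, if Q x then P.real {ω | X ω = x} else 0 := by
  rw [← Finset.sum_filter, ← measureReal_biUnion_finset]
  · congr 1
    ext ω
    simp
  · intro x _ y _ hxy
    exact Set.disjoint_left.2 fun ω hx hy => hxy (hx.symm.trans hy)
  · exact fun x _ => hX x

theorem IsGRG.integrable_likelihood {r : Ω → NodePair n → ℝ} {X : Ω → SimpleGraph (Fin n)}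
    (hX : IsGRG P r X) (x : SimpleGraph (Fin n)) :
    Integrable (fun ω => grgLikelihood (r ω) x) P :=
  integrable_condExp.congr (hX.condProb_eq x)

theorem IsGRG.measureReal_eq [IsFiniteMeasure P] {r : Ω → NodePair n → ℝ}
    {X : Ω → SimpleGraph (Fin n)}
    (hX : IsGRG P r X) (x : SimpleGraph (Fin n)) :
    P.real {ω | X ω = x} = ∫ ω, grgLikelihood (r ω) x ∂P := by
  rw [← integral_congr_ae (hX.condProb_eq x), integral_condExp hX.measurable_odds.comap_le,
    integral_indicator (hX.measurableSet_eq x)]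
  simp

variable {α c : ℝ} {W : Fin n → Ω → ℝ}

theorem ae_mem_of_map_eq_bfryTrunc (hWmeas : ∀ i, Measurable (W i))
    (hWlaw : ∀ i, P.map (W i) = bfryTrunc α c) : ∀ᵐ ω ∂P, ∀ i, W i ω ∈ Set.Ioc 0 c := by
  rw [ae_all_iff]
  intro i
  have h := ae_bfryTrunc_mem α c
  rw [← hWlaw i] at h
  exact ae_of_ae_map (hWmeas i).aemeasurable h

/-- Chebyshev's inequality for the total weight. -/
theorem measureReal_sum_lt_le [IsProbabilityMeasure P] (hn : 0 < n) (hc : 0 < c)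
    (hWmeas : ∀ i, Measurable (W i)) (hWindep : iIndepFun W P)
    (hWlaw : ∀ i, P.map (W i) = bfryTrunc α c) {μ : ℝ} (hμ : μ = ∫ w, w ∂bfryTrunc α c)
    (hμ0 : 0 < μ) :
    P.real {ω | ∑ i, W i ω < n * μ / 2} ≤ 4 * (c / (n * μ)) := by
  have hn0 : (0 : ℝ) < n := by exact_mod_cast hn
  have hae := ae_mem_of_map_eq_bfryTrunc hWmeas hWlaw
  have hmean : ∀ i, ∫ ω, W i ω ∂P = μ := by
    intro i
    rw [hμ, ← hWlaw i, integral_map (hWmeas i).aemeasurable (f := fun w : ℝ => w)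
      measurable_id.aestronglyMeasurable]
  have hmem : ∀ i, MemLp (W i) 2 P := by
    intro i
    refine MemLp.of_bound (hWmeas i).aestronglyMeasurable c ?_
    filter_upwards [hae] with ω hω
    rw [Real.norm_of_nonneg (hω i).1.le]
    exact (hω i).2
  have hint : ∀ i, Integrable (W i) P := fun i => (hmem i).integrable one_le_two
  have hvar : ∀ i, Var[W i; P] ≤ c * μ := by
    intro i
    refine (variance_le_expectation_sq (hWmeas i).aestronglyMeasurable).trans ?_
    rw [← hmean i, ← integral_const_mul]
    refine integral_mono_ae (hmem i).integrable_sq ((hint i).const_mul c) ?_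
    filter_upwards [hae] with ω hω
    simp only [Pi.pow_apply]
    nlinarith [(hω i).1, (hω i).2]
  have hvarsum : Var[∑ i, W i; P] ≤ n * (c * μ) := by
    rw [IndepFun.variance_sum (fun i _ => hmem i)
      (fun i _ j _ hij => hWindep.indepFun hij)]
    refine (Finset.sum_le_sum fun i _ => hvar i).trans ?_
    simp
  have hE : ∫ ω, (∑ i, W i) ω ∂P = n * μ := by
    simp only [Finset.sum_apply]
    rw [integral_finsetSum _ fun i _ => hint i]
    simp [hmean]
  have hcheb := meas_ge_le_variance_div_sq (μ := P) (X := ∑ i, W i)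
    (memLp_finsetSum' _ fun i _ => hmem i) (c := n * μ / 2) (by positivity)
  have hsub : {ω | ∑ i, W i ω < n * μ / 2} ⊆
      {ω | n * μ / 2 ≤ |(∑ i, W i) ω - ∫ ω, (∑ i, W i) ω ∂P|} := by
    intro ω hω
    simp only [Set.mem_ofPred_eq] at hω ⊢
    rw [hE, Finset.sum_apply, abs_sub_comm]
    exact (by linarith : n * μ / 2 ≤ n * μ - ∑ i, W i ω).trans (le_abs_self _)
  calc P.real {ω | ∑ i, W i ω < n * μ / 2}
      ≤ Var[∑ i, W i; P] / (n * μ / 2) ^ 2 := by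
        refine ENNReal.toReal_le_of_le_ofReal (div_nonneg (variance_nonneg _ _) (sq_nonneg _)) ?_
        exact (measure_mono hsub).trans hcheb
    _ ≤ n * (c * μ) / (n * μ / 2) ^ 2 := by gcongr
    _ = 4 * (c / (n * μ)) := by field_simp; norm_num

theorem abs_pgf_sub_exp_le_one (w s : Fin n → ℝ) (hw : ∀ i, 0 < w i) (hs0 : ∀ i, 0 ≤ s i)
    (hs1 : ∀ i, s i ≤ 1) :
    |∏ p : NodePair n,
        (1 - oddsRatio w p / (1 + oddsRatio w p) * (1 - s p.1.1 * s p.1.2)) -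
      Real.exp (-∑ i, w i * (1 - s i))| ≤ 1 := by
  have hr0 : ∀ p : NodePair n, 0 ≤ oddsRatio w p := fun p =>
    div_nonneg (mul_nonneg (hw _).le (hw _).le) (Finset.sum_nonneg fun i _ => (hw i).le)
  have h1 : ∀ p : NodePair n, 0 ≤ oddsRatio w p / (1 + oddsRatio w p) *
      (1 - s p.1.1 * s p.1.2) ∧ oddsRatio w p / (1 + oddsRatio w p) *
      (1 - s p.1.1 * s p.1.2) ≤ 1 := by
    intro p
    have h2 := mul_nonneg (hs0 p.1.1) (hs0 p.1.2)
    have h3 := mul_le_one₀ (hs1 p.1.1) (hs0 p.1.2) (hs1 p.1.2)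
    have h4 : 0 ≤ oddsRatio w p / (1 + oddsRatio w p) :=
      div_nonneg (hr0 p) (by linarith [hr0 p])
    have h5 : oddsRatio w p / (1 + oddsRatio w p) ≤ 1 :=
      div_le_one_of_le₀ (by linarith [hr0 p]) (by linarith [hr0 p])
    exact ⟨mul_nonneg h4 (by linarith), mul_le_one₀ h5 (by linarith) (by linarith)⟩
  have h6 : 0 ≤ ∏ p : NodePair n,
      (1 - oddsRatio w p / (1 + oddsRatio w p) * (1 - s p.1.1 * s p.1.2)) :=
    Finset.prod_nonneg fun p _ => by linarith [(h1 p).2]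
  have h7 : ∏ p : NodePair n,
      (1 - oddsRatio w p / (1 + oddsRatio w p) * (1 - s p.1.1 * s p.1.2)) ≤ 1 :=
    Finset.prod_le_one (fun p _ => by linarith [(h1 p).2]) fun p _ => by linarith [(h1 p).1]
  have h8 : Real.exp (-∑ i, w i * (1 - s i)) ≤ 1 := by
    rw [Real.exp_le_one_iff, neg_nonpos]
    exact Finset.sum_nonneg fun i _ => mul_nonneg (hw i).le (sub_nonneg.2 (hs1 i))
  have h9 := Real.exp_pos (-∑ i, w i * (1 - s i))
  rw [abs_le]
  constructor <;> linarith

theorem abs_pgf_sub_exp_le_sum_min {m : ℕ} (w s : Fin n → ℝ) (v : Fin m ↪ Fin n)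
    (hw : ∀ i, w i ∈ Set.Ioc 0 c) (hs0 : ∀ i, 0 ≤ s i) (hs1 : ∀ i, s i ≤ 1)
    (hsv : ∀ i, i ∉ Set.range v → s i = 1) {b : ℝ} (hb : 0 < b) (hL : b ≤ ∑ i, w i)
    (hc : 0 < c) :
    |∏ p : NodePair n,
        (1 - oddsRatio w p / (1 + oddsRatio w p) * (1 - s p.1.1 * s p.1.2)) -
      Real.exp (-∑ i, w i * (1 - s i))| ≤ ∑ k, min 1 (w (v k) ^ 2 * ((c + 1 + m) / b)) := by
  refine le_sum_min_one _ (fun k _ => by positivity) ?_ ?_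
  · exact abs_pgf_sub_exp_le_one w s (fun i => (hw i).1) hs0 hs1
  · refine (abs_pgf_sub_exp_le w s (fun i => (hw i).1) (fun i => (hw i).2) hs0 hs1).trans ?_
    have hrestrict : ∀ F : Fin n → ℝ, ∑ i, F i * (1 - s i) = ∑ k, F (v k) * (1 - s (v k)) :=
      fun F => (Fintype.sum_of_injective v v.injective _ _
        (fun i hi => by rw [hsv i hi, sub_self, mul_zero]) fun _ => rfl).symm
    obtain ⟨S, hS⟩ : ∃ S, S = ∑ k, w (v k) ^ 2 := ⟨_, rfl⟩
    have hS0 : 0 ≤ S := hS ▸ Finset.sum_nonneg fun k _ => sq_nonneg _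
    have h1 : ∑ i, w i ^ 2 * (1 - s i) ≤ S := by
      rw [hrestrict fun i => w i ^ 2, hS]
      exact Finset.sum_le_sum fun k _ =>
        mul_le_of_le_one_right (sq_nonneg _) (by linarith [hs0 (v k)])
    have h2 : (∑ i, w i * (1 - s i)) ^ 2 ≤ m * S := by
      have h3 : ∑ i, w i * (1 - s i) ≤ ∑ k, w (v k) := by
        rw [hrestrict]
        exact Finset.sum_le_sum fun k _ =>
          mul_le_of_le_one_right (hw _).1.le (by linarith [hs0 (v k)])
      have h4 : 0 ≤ ∑ i, w i * (1 - s i) :=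
        Finset.sum_nonneg fun i _ => mul_nonneg (hw i).1.le (sub_nonneg.2 (hs1 i))
      have h5 := sq_sum_le_card_mul_sum_sq (s := Finset.univ) (f := fun k => w (v k))
      rw [Finset.card_univ, Fintype.card_fin, ← hS] at h5
      exact (pow_le_pow_left₀ h4 h3 2).trans h5
    rw [← Finset.sum_mul, ← hS, ← mul_div_assoc]
    refine div_le_div₀ (by positivity) ?_ hb hL
    nlinarith

/-- The joint generating function of the degrees of some of the nodes is close to a product. -/
theorem abs_sum_measureReal_mul_prod_pow_sub_le [IsProbabilityMeasure P] (hn : 0 < n)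
    (hc : 0 < c) (hWmeas : ∀ i, Measurable (W i)) (hWindep : iIndepFun W P)
    (hWlaw : ∀ i, P.map (W i) = bfryTrunc α c) {X : Ω → SimpleGraph (Fin n)}
    (hX : IsGRG P (fun ω => oddsRatio fun i => W i ω) X) {μ : ℝ}
    (hμ : μ = ∫ w, w ∂bfryTrunc α c) (hμ0 : 0 < μ) {m : ℕ} (v : Fin m ↪ Fin n) (z : Fin m → ℝ)
    (hz0 : ∀ k, 0 ≤ z k) (hz1 : ∀ k, z k ≤ 1) :
    |∑ x, P.real {ω | X ω = x} * ∏ k, z k ^ nodeDegree x (v k) -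
      ∏ k, ∫ w, Real.exp (-(w * (1 - z k))) ∂bfryTrunc α c| ≤
      4 * (c / (n * μ)) +
        m * ∫ w, min 1 (w ^ 2 * ((c + 1 + m) / (n * μ / 2))) ∂bfryTrunc α c := by
  have hn0 : (0 : ℝ) < n := by exact_mod_cast hn
  have hb : 0 < n * μ / 2 := by positivity
  have hae := ae_mem_of_map_eq_bfryTrunc hWmeas hWlaw
  set s : Fin n → ℝ := Function.extend v z 1 with hs
  have hsvk : ∀ k, s (v k) = z k := fun k => v.injective.extend_apply _ _ _
  have hsv : ∀ i, i ∉ Set.range v → s i = 1 := fun i hi =>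
    Function.extend_apply' _ _ _ fun ⟨k, hk⟩ => hi ⟨k, hk⟩
  have hs01 : ∀ i, 0 ≤ s i ∧ s i ≤ 1 := by
    intro i
    by_cases hi : i ∈ Set.range v
    · obtain ⟨k, rfl⟩ := hi
      rw [hsvk]; exact ⟨hz0 k, hz1 k⟩
    · rw [hsv i hi]; exact ⟨zero_le_one, le_rfl⟩
  have hprod : ∀ x : SimpleGraph (Fin n),
      ∏ k, z k ^ nodeDegree x (v k) = ∏ i, s i ^ nodeDegree x i := fun x =>
    Fintype.prod_of_injective v v.injective _ _
      (fun i hi => by rw [hsv i hi, one_pow]) fun k => by rw [hsvk]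
  set A : Ω → ℝ := fun ω => ∏ p : NodePair n,
    (1 - oddsRatio (fun i => W i ω) p / (1 + oddsRatio (fun i => W i ω) p) *
      (1 - s p.1.1 * s p.1.2)) with hA
  set B : Ω → ℝ := fun ω => Real.exp (-∑ i, W i ω * (1 - s i)) with hB
  have hAsum : ∀ ω, A ω = ∑ x, grgLikelihood (oddsRatio fun i => W i ω) x *
      ∏ i, s i ^ nodeDegree x i := fun ω => (sum_grgLikelihood_mul_prod_pow _ _).symm
  have hAint : Integrable A P := by
    have : A = fun ω => ∑ x, grgLikelihood (oddsRatio fun i => W i ω) x *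
      ∏ i, s i ^ nodeDegree x i := funext hAsum
    rw [this]
    exact integrable_finsetSum _ fun x _ => (hX.integrable_likelihood x).mul_const _
  have hA1 : ∑ x, P.real {ω | X ω = x} * ∏ k, z k ^ nodeDegree x (v k) = ∫ ω, A ω ∂P := by
    simp_rw [hAsum]
    rw [integral_finsetSum _ fun x _ => (hX.integrable_likelihood x).mul_const _]
    refine Finset.sum_congr rfl fun x _ => ?_
    rw [integral_mul_const, ← hX.measureReal_eq x, hprod]
  have hBprod : B = fun ω => ∏ k, Real.exp (-(W (v k) ω * (1 - z k))) := by
    ext ω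
    have hsum : ∑ i, W i ω * (1 - s i) = ∑ k, W (v k) ω * (1 - z k) :=
      (Fintype.sum_of_injective v v.injective (fun k => W (v k) ω * (1 - z k))
        (fun i => W i ω * (1 - s i)) (fun i hi => by rw [hsv i hi, sub_self, mul_zero])
        fun k => by rw [hsvk]).symm
    rw [← Real.exp_sum, Finset.sum_neg_distrib, ← hsum]
  have hBmeas : Measurable B := by fun_prop
  have hBint : Integrable B P := by
    refine Integrable.of_bound hBmeas.aestronglyMeasurable 1 ?_
    filter_upwards [hae] with ω hω
    rw [Real.norm_of_nonneg (Real.exp_pos _).le, Real.exp_le_one_iff, neg_nonpos]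
    exact Finset.sum_nonneg fun i _ => mul_nonneg (hω i).1.le (sub_nonneg.2 (hs01 i).2)
  have hB1 : ∏ k, ∫ w, Real.exp (-(w * (1 - z k))) ∂bfryTrunc α c = ∫ ω, B ω ∂P := by
    rw [hBprod]
    have hind : iIndepFun (fun k => W (v k)) P := hWindep.precomp v.injective
    rw [hind.integral_fun_prod_comp (f := fun k w => Real.exp (-(w * (1 - z k))))
      (fun k => (hWmeas _).aemeasurable)
      (fun k => (by fun_prop : Measurable _).aestronglyMeasurable)]
    refine Finset.prod_congr rfl fun k _ => ?_
    rw [← hWlaw (v k), integral_map (hWmeas _).aemeasurable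
      (by fun_prop : Measurable _).aestronglyMeasurable]
  set δ : ℝ := (c + 1 + m) / (n * μ / 2) with hδ
  have hδ0 : 0 ≤ δ := by positivity
  have hminmeas : Measurable fun w : ℝ => min 1 (w ^ 2 * δ) := by fun_prop
  have hminint : ∀ i, Integrable (fun ω => min 1 (W i ω ^ 2 * δ)) P := fun i =>
    Integrable.of_bound (hminmeas.comp (hWmeas i)).aestronglyMeasurable 1
      (.of_forall fun ω => by
        rw [Real.norm_of_nonneg (le_min zero_le_one (by positivity))]
        exact min_le_left _ _)
  set E : Set Ω := {ω | ∑ i, W i ω < n * μ / 2} with hE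
  have hEmeas : MeasurableSet E := measurableSet_lt (by fun_prop) measurable_const
  have hEint : Integrable (E.indicator fun _ => (1 : ℝ)) P :=
    (integrable_const 1).indicator hEmeas
  have hle : ∀ᵐ ω ∂P, |A ω - B ω| ≤
      E.indicator (fun _ => (1 : ℝ)) ω + ∑ k, min 1 (W (v k) ω ^ 2 * δ) := by
    filter_upwards [hae] with ω hω
    have hmin0 : 0 ≤ ∑ k, min 1 (W (v k) ω ^ 2 * δ) :=
      Finset.sum_nonneg fun k _ => le_min zero_le_one (by positivity)
    by_cases hωE : ω ∈ E
    · rw [Set.indicator_of_mem hωE]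
      refine le_add_of_le_of_nonneg ?_ hmin0
      exact abs_pgf_sub_exp_le_one (fun i => W i ω) s (fun i => (hω i).1)
        (fun i => (hs01 i).1) fun i => (hs01 i).2
    · rw [Set.indicator_of_notMem hωE, zero_add]
      exact abs_pgf_sub_exp_le_sum_min (fun i => W i ω) s v hω (fun i => (hs01 i).1)
        (fun i => (hs01 i).2) hsv hb (not_lt.1 hωE) hc
  rw [hA1, hB1, ← integral_sub hAint hBint]
  calc |∫ ω, A ω - B ω ∂P| ≤ ∫ ω, |A ω - B ω| ∂P := abs_integral_le_integral_abs
    _ ≤ ∫ ω, E.indicator (fun _ => (1 : ℝ)) ω + ∑ k, min 1 (W (v k) ω ^ 2 * δ) ∂P :=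
        integral_mono_ae (hAint.sub hBint).abs
          (hEint.add (integrable_finsetSum _ fun k _ => hminint (v k))) hle
    _ = P.real E + m * ∫ w, min 1 (w ^ 2 * δ) ∂bfryTrunc α c := by
        rw [integral_add hEint (integrable_finsetSum _ fun k _ => hminint (v k)),
          integral_indicator_const _ hEmeas, integral_finsetSum _ fun k _ => hminint (v k)]
        have h1 : ∀ i, ∫ ω, min 1 (W i ω ^ 2 * δ) ∂P =
            ∫ w, min 1 (w ^ 2 * δ) ∂bfryTrunc α c := fun i => by
          rw [← hWlaw i, integral_map (hWmeas i).aemeasurable hminmeas.aestronglyMeasurable]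
        simp [h1]
    _ ≤ _ := by
        gcongr
        exact measureReal_sum_lt_le hn hc hWmeas hWindep hWlaw hμ hμ0

end FixedSize

theorem tendsto_const_div_mul_integral_bfryTrunc {α : ℝ} (hα0 : 0 < α) (hα1 : α < 1) {C : ℕ → ℝ}
    (hCtop : Tendsto C atTop atTop)
    (hCn : Tendsto (fun n : ℕ => C n ^ α / (n : ℝ)) atTop (𝓝 0)) :
    Tendsto (fun n : ℕ => C n / (n * ∫ w, w ∂bfryTrunc α (C n))) atTop (𝓝 0) := by
  obtain ⟨κ, hκ, hle⟩ := exists_le_integral_bfryTrunc hα0 hα1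
  have h := hCn.div_const κ
  rw [zero_div] at h
  refine squeeze_zero' ?_ ?_ h
  · filter_upwards [hCtop.eventually_ge_atTop 2] with n hn
    have hc0 : 0 < C n := by linarith
    have h1 := hle _ hn
    have h2 : 0 < C n ^ (-α) := Real.rpow_pos_of_pos hc0 _
    have h3 : 0 ≤ ∫ w, w ∂bfryTrunc α (C n) := (by positivity : (0 : ℝ) ≤ _).trans h1
    positivity
  · filter_upwards [hCtop.eventually_ge_atTop 2, eventually_gt_atTop 0] with n hn hn0
    have hn0' : (0 : ℝ) < n := by exact_mod_cast hn0
    have hc0 : 0 < C n := by linarith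
    have h2 : 0 < C n ^ (-α) := Real.rpow_pos_of_pos hc0 _
    calc C n / (n * ∫ w, w ∂bfryTrunc α (C n)) ≤ C n / (n * (κ * (C n * C n ^ (-α)))) := by
          gcongr; exact hle _ hn
      _ = C n ^ α / n / κ := by
          rw [Real.rpow_neg hc0.le]
          have := Real.rpow_pos_of_pos hc0 α
          field_simp

section Main

variable {α : ℝ} {C : ℕ → ℝ} {Ω : ℕ → Type*} [∀ n, MeasurableSpace (Ω n)]
  {P : ∀ n, Measure (Ω n)} [∀ n, IsProbabilityMeasure (P n)] {W : ∀ n, Fin n → Ω n → ℝ}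
  {X : ∀ n, Ω n → SimpleGraph (Fin n)}

/-- The degrees of distinct nodes converge jointly to independent mixed Poisson variables,
uniformly over the choice of the nodes. -/
theorem tendsto_measureReal_nodeDegree (hα0 : 0 < α) (hα1 : α < 1)
    (hCtop : Tendsto C atTop atTop)
    (hCn : Tendsto (fun n : ℕ => C n ^ α / (n : ℝ)) atTop (𝓝 0))
    (hWmeas : ∀ n i, Measurable (W n i)) (hWindep : ∀ n, iIndepFun (W n) (P n))
    (hWlaw : ∀ n i, (P n).map (W n i) = bfryTrunc α (C n))
    (hX : ∀ n, IsGRG (P n) (fun ω => oddsRatio fun i => W n i ω) (X n))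
    {m : ℕ} (A : Fin m → Set ℕ) {ε : ℝ} (hε : 0 < ε) :
    ∀ᶠ n in atTop, ∀ v : Fin m ↪ Fin n,
      |(P n).real {ω | ∀ k, nodeDegree (X n ω) (v k) ∈ A k} -
        ∏ k, ∑' y, (A k).indicator (mixedPoissonMass (bfry α)) y| < ε := by
  classical
  let ι := Σ n : ℕ, (Fin m ↪ Fin n)
  let l : Filter ι := comap Sigma.fst atTop
  have hfst : Tendsto (Sigma.fst : ι → ℕ) l atTop := tendsto_comap
  have hq : HasSum (mixedPoissonMass (bfry α)) 1 := by
    have := hasSum_mixedPoissonMass_mul_pow hα0 hα1 zero_le_one le_rfl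
    simpa only [one_pow, mul_one, sub_self, mul_zero, neg_zero, Real.exp_zero,
      integral_bfry_one hα0 hα1] using this
  have hratio := tendsto_const_div_mul_integral_bfryTrunc hα0 hα1 hCtop hCn
  have hδ : Tendsto (fun n : ℕ => (C n + 1 + m) / (n * (∫ w, w ∂bfryTrunc α (C n)) / 2)) atTop
      (𝓝 0) := by
    have h1 : Tendsto (fun n : ℕ => 2 * (1 + (1 + m) * (C n)⁻¹) *
        (C n / (n * ∫ w, w ∂bfryTrunc α (C n)))) atTop (𝓝 0) := by
      have := (((hCtop.inv_tendsto_atTop.const_mul (1 + (m : ℝ))).const_add 1).const_mul 2).mul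
        hratio
      simpa using this
    refine h1.congr' ?_
    filter_upwards [hCtop.eventually_gt_atTop 0] with n hn
    rw [div_div_eq_mul_div, mul_div_assoc']
    congr 1
    field_simp
    ring
  have herr : Tendsto (fun n : ℕ => 4 * (C n / (n * ∫ w, w ∂bfryTrunc α (C n))) +
      m * ∫ w, min 1 (w ^ 2 * ((C n + 1 + m) / (n * (∫ w, w ∂bfryTrunc α (C n)) / 2)))
        ∂bfryTrunc α (C n)) atTop (𝓝 0) := by
    have hnonneg : ∀ᶠ n : ℕ in atTop,
        0 ≤ (C n + 1 + m) / (n * (∫ w, w ∂bfryTrunc α (C n)) / 2) := by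
      filter_upwards [hCtop.eventually_gt_atTop 0] with n hn
      have h1 : 0 ≤ ∫ w, w ∂bfryTrunc α (C n) :=
        integral_nonneg_of_ae ((ae_bfryTrunc_mem α (C n)).mono fun w hw => hw.1.le)
      positivity
    have h2 := tendsto_integral_bfryTrunc (f := fun _ => 0) hα0 hα1 hCtop
      (F := fun n w => min 1 (w ^ 2 * ((C n + 1 + m) / (n * (∫ w, w ∂bfryTrunc α (C n)) / 2))))
      (fun n => by fun_prop) (by
        filter_upwards [hnonneg] with n hn w _
        rw [abs_of_nonneg (le_min zero_le_one (mul_nonneg (sq_nonneg _) hn))]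
        exact min_le_left _ _) (fun w _ => by
        have := (tendsto_const_nhds (x := (1 : ℝ))).min (hδ.const_mul (w ^ 2))
        simpa using this)
    have h3 := (hratio.const_mul 4).add (h2.const_mul (m : ℝ))
    simpa using h3
  have hpgf : ∀ z : Fin m → ℝ, (∀ k, 0 ≤ z k) → (∀ k, z k ≤ 1) →
      Tendsto (fun i : ι => ∑ x, (P i.1).real {ω | X i.1 ω = x} *
        ∏ k, z k ^ nodeDegree x (i.2 k)) l
        (𝓝 (∏ k, ∑' y, mixedPoissonMass (bfry α) y * z k ^ y)) := by
    intro z hz0 hz1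
    have h1 : Tendsto (fun n => ∏ k, ∫ w, Real.exp (-(w * (1 - z k))) ∂bfryTrunc α (C n)) atTop
        (𝓝 (∏ k, ∑' y, mixedPoissonMass (bfry α) y * z k ^ y)) := by
      refine tendsto_finsetProd _ fun k _ => ?_
      rw [(hasSum_mixedPoissonMass_mul_pow hα0 hα1 (hz0 k) (hz1 k)).tsum_eq]
      refine tendsto_integral_bfryTrunc hα0 hα1 hCtop (fun n => by fun_prop) (.of_forall ?_)
        fun w _ => tendsto_const_nhds
      intro n w hw
      rw [abs_of_pos (Real.exp_pos _), Real.exp_le_one_iff, neg_nonpos]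
      exact mul_nonneg hw.le (sub_nonneg.2 (hz1 k))
    have h2 : Tendsto (fun i : ι => ∑ x, (P i.1).real {ω | X i.1 ω = x} *
        ∏ k, z k ^ nodeDegree x (i.2 k) -
        ∏ k, ∫ w, Real.exp (-(w * (1 - z k))) ∂bfryTrunc α (C i.1)) l (𝓝 0) := by
      refine squeeze_zero_norm' ?_ (herr.comp hfst)
      obtain ⟨κ, hκ, hle⟩ := exists_le_integral_bfryTrunc hα0 hα1
      have hev : ∀ᶠ n in atTop, 2 ≤ C n ∧ 0 < n :=
        (hCtop.eventually_ge_atTop 2).and (eventually_gt_atTop 0)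
      filter_upwards [hfst.eventually hev] with i hi
      have hc0 : 0 < C i.1 := by linarith [hi.1]
      have hμ0 : 0 < ∫ w, w ∂bfryTrunc α (C i.1) :=
        lt_of_lt_of_le (mul_pos hκ (mul_pos hc0 (Real.rpow_pos_of_pos hc0 _))) (hle _ hi.1)
      exact abs_sum_measureReal_mul_prod_pow_sub_le hi.2 hc0 (hWmeas i.1) (hWindep i.1)
        (hWlaw i.1) (hX i.1) rfl hμ0 i.2 z hz0 hz1
    have h3 := h2.add (h1.comp hfst)
    rw [zero_add] at h3
    exact h3.congr fun i => sub_add_cancel _ _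
  have key := tendsto_sum_ite_of_tendsto_pgf (l := l)
    (p := fun (i : ι) x => (P i.1).real {ω | X i.1 ω = x})
    (D := fun i x k => nodeDegree x (i.2 k)) (fun _ _ => measureReal_nonneg)
    (fun i => by
      have := measureReal_eq_sum_graph (P := P i.1) (hX i.1).measurableSet_eq fun _ => True
      simpa using this.symm)
    (mixedPoissonMass_nonneg α) hq hpgf A
  have hball := Metric.tendsto_nhds.1 key ε hε
  rw [eventually_comap] at hball
  filter_upwards [hball] with n hn v
  have h := hn ⟨n, v⟩ rfl
  rw [Real.dist_eq] at h
  rw [measureReal_eq_sum_graph (hX n).measurableSet_eq fun x => ∀ k, nodeDegree x (v k) ∈ A k]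
  convert h

end Main

theorem theorem1 (α : ℝ) (hα0 : 0 < α) (hα1 : α < 1)
    (C : ℕ → ℝ) (hCpos : ∀ n, 1 ≤ n → 0 < C n)
    (hCtop : Tendsto C atTop atTop)
    (hCn : Tendsto (fun n : ℕ => C n ^ α / (n : ℝ)) atTop (𝓝 0))
    {Ω : ℕ → Type*} [∀ n, MeasurableSpace (Ω n)]
    (P : ∀ n, Measure (Ω n)) [∀ n, IsProbabilityMeasure (P n)]
    (W : ∀ n, Fin n → Ω n → ℝ)
    (hWmeas : ∀ n i, Measurable (W n i))
    (hWindep : ∀ n, iIndepFun (W n) (P n))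
    (hWlaw : ∀ n i, (P n).map (W n i) = bfryTrunc α (C n))
    (X : ∀ n, Ω n → SimpleGraph (Fin n))
    (hX : ∀ n, IsGRG (P n) (fun ω => oddsRatio fun i => W n i ω) (X n)) :
    -- (1) the degree of each node converges in law to the mixed Poisson law with BFRY mixing,
    -- uniformly over the nodes; this limit law is explicit and has a power law tail
    ((∀ y : ℕ, ∀ ε > 0, ∀ᶠ n in atTop, ∀ i : Fin n,
        |(P n).real {ω | nodeDegree (X n ω) i = y} - mixedPoissonMass (bfry α) y| < ε) ∧
      (∀ y : ℕ, mixedPoissonMass (bfry α) y =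
        α * Real.Gamma ((y : ℝ) - α) * (1 - (2 : ℝ) ^ (α - (y : ℝ))) /
          ((y.factorial : ℝ) * Real.Gamma (1 - α))) ∧
      (∃ c : ℝ, 0 < c ∧
        (fun y : ℕ => mixedPoissonMass (bfry α) y) ~[atTop]
          fun y : ℕ => c * (y : ℝ) ^ (-1 - α))) ∧
    -- (2) the degrees of the first `m` nodes are asymptotically independent
    (∀ m : ℕ, ∀ A : Fin m → Set ℕ, ∀ ε > 0, ∀ᶠ n in atTop, ∀ h : m ≤ n,
      |(P n).real {ω | ∀ k : Fin m, nodeDegree (X n ω) (Fin.castLE h k) ∈ A k} -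
        ∏ k : Fin m, (P n).real {ω | nodeDegree (X n ω) (Fin.castLE h k) ∈ A k}| < ε) := by
  have hunif : ∀ A : Set ℕ, ∀ ε > 0, ∀ᶠ n in atTop, ∀ i : Fin n,
      |(P n).real {ω | nodeDegree (X n ω) i ∈ A} -
        ∑' y, A.indicator (mixedPoissonMass (bfry α)) y| < ε := by
    intro A ε hε
    filter_upwards [tendsto_measureReal_nodeDegree hα0 hα1 hCtop hCn hWmeas hWindep hWlaw hX
      (m := 1) (fun _ => A) hε] with n hn i
    have h : |(P n).real {ω | ∀ _k : Fin 1, nodeDegree (X n ω) i ∈ A} -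
        ∏ _k : Fin 1, ∑' y, A.indicator (mixedPoissonMass (bfry α)) y| < ε :=
      hn ⟨fun _ => i, fun _ _ _ => Subsingleton.elim _ _⟩
    simpa only [forall_const, Finset.univ_unique, Finset.prod_singleton] using h
  refine ⟨⟨fun y ε hε => ?_, mixedPoissonMass_bfry hα0 hα1,
    isEquivalent_mixedPoissonMass_bfry hα0 hα1⟩, fun m A ε hε => ?_⟩
  · filter_upwards [hunif {y} ε hε] with n hn i
    have h1 : ∑' x, ({y} : Set ℕ).indicator (mixedPoissonMass (bfry α)) x =
        mixedPoissonMass (bfry α) y := by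
      rw [tsum_eq_single y fun x hx => Set.indicator_of_notMem (by simpa using hx) _]
      exact Set.indicator_of_mem rfl _
    simpa only [h1, Set.mem_singleton_iff] using hn i
  · let ι := {n : ℕ // m ≤ n}
    let l : Filter ι := comap Subtype.val atTop
    have hval : Tendsto (Subtype.val : ι → ℕ) l atTop := tendsto_comap
    have h1 : Tendsto (fun i : ι => (P i.1).real
        {ω | ∀ k : Fin m, nodeDegree (X i.1 ω) (Fin.castLE i.2 k) ∈ A k}) l
        (𝓝 (∏ k, ∑' y, (A k).indicator (mixedPoissonMass (bfry α)) y)) := by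
      rw [Metric.tendsto_nhds]
      intro ε hε
      filter_upwards [hval.eventually (tendsto_measureReal_nodeDegree hα0 hα1 hCtop hCn hWmeas
        hWindep hWlaw hX A hε)] with i hi
      rw [Real.dist_eq]
      exact hi (Fin.castLEEmb i.2)
    have h2 : Tendsto (fun i : ι => ∏ k : Fin m, (P i.1).real
        {ω | nodeDegree (X i.1 ω) (Fin.castLE i.2 k) ∈ A k}) l
        (𝓝 (∏ k, ∑' y, (A k).indicator (mixedPoissonMass (bfry α)) y)) := by
      refine tendsto_finsetProd _ fun k _ => ?_
      rw [Metric.tendsto_nhds]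
      intro ε hε
      filter_upwards [hval.eventually (hunif (A k) ε hε)] with i hi
      rw [Real.dist_eq]
      exact hi _
    have h3 := h1.sub h2
    rw [sub_self] at h3
    have hball := Metric.tendsto_nhds.1 h3 ε hε
    rw [eventually_comap] at hball
    filter_upwards [hball] with n hn h
    simpa only [Real.dist_eq, sub_zero] using hn ⟨n, h⟩ rfl
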